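/- Consider $n$ linear time-invariant subsystems $\dot x_i=\mathcal A_i x_i+\mathcal B_i w_i$, $z_i=\mathcal C_i x_i$ $(i=1,\dots,n)$ with real matrices and every $\mathcal A_i$ Hurwitz (all eigenvalues have negative real part), interconnected by $w=Mz+Ku$, $y=Nz$, where $w,z$ stack the $w_i,z_i$ and where $u=(u_1,\dots,u_{n_i})$, $y=(y_1,\dots,y_{n_o})$ are partitioned external input and output. The constant real matrices $M=(M_{ij})$, $K=(K_{il})$, $N=(N_{kj})$ are partitioned accordingly, and $M_{ii}=0$ for all $i$. The interconnected system is $\dot x=Ax+Bu$, $y=Cx$ with $A=\mathcal A+\mathcal B M\mathcal C$, $B=\mathcal B K$, $C=N\mathcal C$, where $\mathcal A=\mathrm{diag}(\mathcal A_1,\dots,\mathcal A_n)$ and similarly for $\mathcal B,\mathcal C$. Write $\|X\|_2=\overline\sigma(X)$ for the largest singular value and $\|T\|_{\mathcal H_\infty}=\sup_{\omega\in\mathbb R}\|T(\imath\omega)\|_2$. Define the comparison system matrices $F\in\mathbb R^{n\times n}$, $G\in\mathbb R^{n\times n_i}$, $H\in\mathbb R^{n_o\times n}$ by $$F_{ii}=-1,\qquad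 F_{ij}=\|\mathcal C_i(sI-\mathcal A_i)^{-1}\mathcal B_iM_{ij}\|_{\mathcal H_\infty}\ (i\ne j),\qquad G_{il}=\|\mathcal C_i(sI-\mathcal A_i)^{-1}\mathcal B_iK_{il}\|_{\mathcal H_\infty},\qquad H_{kj}=\overline\sigma(N_{kj}).$$ Suppose that for some $\delta>0$ there are entrywise positive vectors $d,e\in\mathbb R^n$, $f\in\mathbb R^{n_i}$, $g\in\mathbb R^{n_o}$ such that, entrywise, $$Fd+Gf<0,\qquad Hd\le g,\qquad F^{\mathsf T}e+H^{\mathsf T}g<0,\qquad G^{\mathsf T}e<\delta^2 f.$$ Then the following hold. (i) Put $\phi_{ii}=e_i/d_i$ and $Y^i_{11}=\phi_{ii}I\succ0$. There are symmetric matrices $Y_{22}^i\succ0$ and $\mathcal P_i\succ0$ $(i=1,\dots,n)$ such that the local dissipativity conditions $$\begin{bmatrix}\mathcal P_i\mathcal A_i+\mathcal A_i^{\mathsf T}\mathcal P_i+\mathcal C_i^{\mathsf T}Y^i_{11}\mathcal C_i&\mathcal P_i\mathcal B_i\\ \mathcal B_i^{\mathsf T}\mathcal P_i&-Y^i_{22}\end{bmatrix}\preceq0,\qquad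 i=1,\dots,n,$$ hold (supply rates $Y^i=\mathrm{diag}(Y^i_{11},-Y^i_{22})$, that is, $Y^i_{12}=0$), together with the global coupling condition for the supply rate $W=\mathrm{diag}(I,-\delta^2I)$, $$\begin{bmatrix}M&K\\N&0\\I&0\\0&I\end{bmatrix}^{\mathsf T}T_\pi^{\mathsf T}\,Q\,T_\pi\begin{bmatrix}M&K\\N&0\\I&0\\0&I\end{bmatrix}\preceq0,\qquad Q=\mathrm{diag}(-Y^1,\dots,-Y^n,W),$$ where $T_\pi$ is the permutation matrix that maps the vector with ordering $(w,y,z,u)$ to the one with ordering $(z_1,w_1,\dots,z_n,w_n,y,u)$. (ii) There is a block-diagonal $P=\mathrm{diag}(P_1,\dots,P_n)$ with all $P_i\succ0$ such that $$PA+A^{\mathsf T}P+C^{\mathsf T}C+\tfrac1{\delta^2}PBB^{\mathsf T}P\prec0.$$ Moreover $A$ is Hurwitz and $\|C(sI-A)^{-1}B\|_{\mathcal H_\infty}<\delta$. -/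

import Mathlib

namespace SmallGain

open Matrix

/-- `X ≺ 0`. -/
def NegDef {a : Type*} (X : Matrix a a ℝ) : Prop := (-X).PosDef

/-- `X ⪯ 0`. -/
def NegSemidef {a : Type*} (X : Matrix a a ℝ) : Prop := (-X).PosSemidef

/-- A real square matrix is Hurwitz if all its (complex) eigenvalues have negative real part. -/
def IsHurwitz {a : Type*} [Fintype a] [DecidableEq a] (A : Matrix a a ℝ) : Prop :=
  ∀ μ ∈ spectrum ℂ (A.map ((↑) : ℝ → ℂ)), μ.re < 0

section Norms

open scoped Matrix.Norms.L2Operator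

/-- The maximal singular value `‖X‖₂ = σ̄(X)`, i.e. the operator norm of `X` between Euclidean
spaces. -/
noncomputable def sigmaMax {𝕜 : Type*} [RCLike 𝕜] {a b : Type*} [Fintype a] [Fintype b]
    [DecidableEq b] (X : Matrix a b 𝕜) : ℝ := ‖X‖

end Norms

/-- The transfer function `s ↦ C (s I - A)⁻¹ B`. -/
noncomputable def transfer {a b c : Type*} [Fintype a] [DecidableEq a]
    (A : Matrix a a ℝ) (B : Matrix a b ℝ) (C : Matrix c a ℝ) (s : ℂ) : Matrix c b ℂ :=
  C.map ((↑) : ℝ → ℂ) * (s • (1 : Matrix a a ℂ) - A.map ((↑) : ℝ → ℂ))⁻¹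
    * B.map ((↑) : ℝ → ℂ)

/-- The `H∞` norm `sup_{ω ∈ ℝ} ‖T(iω)‖₂` of an asymptotically stable transfer function. (It is
only used for realizations with Hurwitz state matrix, for which the supremum is finite.) -/
noncomputable def hInfNorm {b c : Type*} [Fintype b] [Fintype c] [DecidableEq b]
    (T : ℂ → Matrix c b ℂ) : ℝ := ⨆ ω : ℝ, sigmaMax (T (Complex.I * (ω : ℂ)))

/-- The `(i, j)` block of a partitioned matrix. -/
def block {ι κ : Type*} {a : ι → Type*} {b : κ → Type*}
    (X : Matrix (Σ i, a i) (Σ j, b j) ℝ) (i : ι) (j : κ) : Matrix (a i) (b j) ℝ :=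
  X.submatrix (Sigma.mk i) (Sigma.mk j)

/-- The linear programming conditions of the positive system `(F, G, H, J)` at level `δ`
(all vector inequalities are entrywise):
`F d + G f < 0`, `H d + J f ≤ g`, `Fᵀ e + Hᵀ g < 0`, `Gᵀ e + Jᵀ g < δ² f`. -/
def LPConditions {x u y : Type*} [Fintype x] [Fintype u] [Fintype y]
    (F : Matrix x x ℝ) (G : Matrix x u ℝ) (H : Matrix y x ℝ) (J : Matrix y u ℝ)
    (δ : ℝ) (d e : x → ℝ) (f : u → ℝ) (g : y → ℝ) : Prop :=
  (∀ i, (F *ᵥ d + G *ᵥ f) i < 0) ∧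
  (∀ k, (H *ᵥ d + J *ᵥ f) k ≤ g k) ∧
  (∀ i, (Fᵀ *ᵥ e + Hᵀ *ᵥ g) i < 0) ∧
  (∀ l, (Gᵀ *ᵥ e + Jᵀ *ᵥ g) l < δ ^ 2 * f l)

/-- Data of a network of `n` subsystems
`ẋ i = A i x i + B i w i`, `z i = C i x i`, interconnected through `w = M z + K u`, `y = N z`.
Subsystem `i` has state, input and output dimensions `nx i`, `nw i`, `nz i`; the external input
consists of `nI` blocks of dimensions `nu l`, the external output of `nO` blocks of
dimensions `ny k`. -/
structure Network (n nI nO : ℕ) (nx nw nz : Fin n → ℕ) (nu : Fin nI → ℕ) (ny : Fin nO → ℕ) where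
  /-- state matrices of the subsystems -/
  A : ∀ i, Matrix (Fin (nx i)) (Fin (nx i)) ℝ
  /-- input matrices of the subsystems -/
  B : ∀ i, Matrix (Fin (nx i)) (Fin (nw i)) ℝ
  /-- output matrices of the subsystems -/
  C : ∀ i, Matrix (Fin (nz i)) (Fin (nx i)) ℝ
  /-- interconnection from subsystem outputs to subsystem inputs -/
  M : Matrix (Σ i, Fin (nw i)) (Σ i, Fin (nz i)) ℝ
  /-- map from subsystem outputs to the external output -/
  N : Matrix (Σ k, Fin (ny k)) (Σ i, Fin (nz i)) ℝ
  /-- map from the external input to subsystem inputs -/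
  K : Matrix (Σ i, Fin (nw i)) (Σ l, Fin (nu l)) ℝ

namespace Network

variable {n nI nO : ℕ} {nx nw nz : Fin n → ℕ} {nu : Fin nI → ℕ} {ny : Fin nO → ℕ}

/-- State matrix of the interconnected system. -/
def fullA (S : Network n nI nO nx nw nz nu ny) : Matrix (Σ i, Fin (nx i)) (Σ i, Fin (nx i)) ℝ :=
  blockDiagonal' S.A + blockDiagonal' S.B * S.M * blockDiagonal' S.C

/-- Input matrix of the interconnected system. -/
def fullB (S : Network n nI nO nx nw nz nu ny) : Matrix (Σ i, Fin (nx i)) (Σ l, Fin (nu l)) ℝ :=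
  blockDiagonal' S.B * S.K

/-- Output matrix of the interconnected system. -/
def fullC (S : Network n nI nO nx nw nz nu ny) : Matrix (Σ k, Fin (ny k)) (Σ i, Fin (nx i)) ℝ :=
  S.N * blockDiagonal' S.C

/-- State matrix `F` of the comparison system. -/
noncomputable def compF (S : Network n nI nO nx nw nz nu ny) : Matrix (Fin n) (Fin n) ℝ :=
  Matrix.of fun i j =>
    if i = j then -1 else hInfNorm (transfer (S.A i) (S.B i * block S.M i j) (S.C i))

/-- Input matrix `G` of the comparison system. -/
noncomputable def compG (S : Network n nI nO nx nw nz nu ny) : Matrix (Fin n) (Fin nI) ℝ :=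
  Matrix.of fun i l => hInfNorm (transfer (S.A i) (S.B i * block S.K i l) (S.C i))

/-- Output matrix `H` of the comparison system. -/
noncomputable def compH (S : Network n nI nO nx nw nz nu ny) : Matrix (Fin nO) (Fin n) ℝ :=
  Matrix.of fun k j => sigmaMax (block S.N k j)

end Network

/-- The supply rate matrix `[W₁₁, W₁₂; W₁₂ᵀ, -W₂₂]`, acting on (output, input). -/
def supplyMatrix {o i : Type*} (W11 : Matrix o o ℝ) (W12 : Matrix o i ℝ) (W22 : Matrix i i ℝ) :
    Matrix (o ⊕ i) (o ⊕ i) ℝ :=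
  fromBlocks W11 W12 W12ᵀ (-W22)

/-- Local dissipativity condition of the subsystem `(A, B, C)` with storage function `xᵀ P x` and
supply rate `Y = [Y₁₁, Y₁₂; Y₁₂ᵀ, -Y₂₂]`:  `Y = Yᵀ`, `P ≻ 0` and
`[P A + Aᵀ P + Cᵀ Y₁₁ C, P B + Cᵀ Y₁₂; *, -Y₂₂] ⪯ 0`. -/
def LocalSupplyCond {x w z : Type*} [Fintype x] [Fintype w] [Fintype z]
    (A : Matrix x x ℝ) (B : Matrix x w ℝ) (C : Matrix z x ℝ) (P : Matrix x x ℝ)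
    (Y11 : Matrix z z ℝ) (Y12 : Matrix z w ℝ) (Y22 : Matrix w w ℝ) : Prop :=
  (supplyMatrix Y11 Y12 Y22).IsSymm ∧ P.PosDef ∧
  NegSemidef (fromBlocks
    (P * A + Aᵀ * P + Cᵀ * Y11 * C) (P * B + Cᵀ * Y12)
    (P * B + Cᵀ * Y12)ᵀ (-Y22))

section Coupling

variable {ι : Type*} {w z : ι → Type*} {u y : Type*}

/-- The relabelling of coordinates that sends the ordering
`(z₁, w₁, …, zₙ, wₙ, y, u)` to the ordering `(w, y, z, u)`. -/
def reorder : ((Σ i, z i ⊕ w i) ⊕ (y ⊕ u)) → (((Σ i, w i) ⊕ y) ⊕ ((Σ i, z i) ⊕ u))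
  | Sum.inl ⟨i, Sum.inl a⟩ => Sum.inr (Sum.inl ⟨i, a⟩)
  | Sum.inl ⟨i, Sum.inr b⟩ => Sum.inl (Sum.inl ⟨i, b⟩)
  | Sum.inr (Sum.inl c) => Sum.inl (Sum.inr c)
  | Sum.inr (Sum.inr v) => Sum.inr (Sum.inr v)

variable [Fintype ι] [DecidableEq ι] [∀ i, Fintype (w i)] [∀ i, DecidableEq (w i)]
  [∀ i, Fintype (z i)] [∀ i, DecidableEq (z i)] [Fintype u] [DecidableEq u]
  [Fintype y] [DecidableEq y]

/-- The permutation matrix `T_π` with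
`(z₁, w₁, …, zₙ, wₙ, y, u) = T_π (w, y, z, u)`. -/
def permT (w z : ι → Type*) (u y : Type*) [∀ i, DecidableEq (w i)] [∀ i, DecidableEq (z i)]
    [DecidableEq u] [DecidableEq y] :
    Matrix ((Σ i, z i ⊕ w i) ⊕ (y ⊕ u)) (((Σ i, w i) ⊕ y) ⊕ ((Σ i, z i) ⊕ u)) ℝ :=
  Matrix.of fun a b => if reorder a = b then 1 else 0

/-- The matrix `[M, K; N, 0; I, 0; 0, I]`, which maps `(z, u)` to `(w, y, z, u)`. -/
def couplingMap (M : Matrix (Σ i, w i) (Σ i, z i) ℝ) (N : Matrix y (Σ i, z i) ℝ)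
    (K : Matrix (Σ i, w i) u ℝ) :
    Matrix (((Σ i, w i) ⊕ y) ⊕ ((Σ i, z i) ⊕ u)) ((Σ i, z i) ⊕ u) ℝ :=
  fromRows (fromBlocks M K N 0) 1

/-- `Q = diag(-Y¹, …, -Yⁿ, W)`. -/
def supplyQ (Y : ∀ i, Matrix (z i ⊕ w i) (z i ⊕ w i) ℝ) (W : Matrix (y ⊕ u) (y ⊕ u) ℝ) :
    Matrix ((Σ i, z i ⊕ w i) ⊕ (y ⊕ u)) ((Σ i, z i ⊕ w i) ⊕ (y ⊕ u)) ℝ :=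
  fromBlocks (blockDiagonal' fun i => -Y i) 0 0 W

/-- The centralised coupling constraint with local supply rates `Y i` and the (symmetric) global
supply rate `W`. -/
def GlobalSupplyCond (M : Matrix (Σ i, w i) (Σ i, z i) ℝ) (N : Matrix y (Σ i, z i) ℝ)
    (K : Matrix (Σ i, w i) u ℝ) (Y : ∀ i, Matrix (z i ⊕ w i) (z i ⊕ w i) ℝ)
    (W : Matrix (y ⊕ u) (y ⊕ u) ℝ) : Prop :=
  W.IsSymm ∧
  NegSemidef ((couplingMap M N K)ᵀ * ((permT w z u y)ᵀ * supplyQ Y W * permT w z u y)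
    * couplingMap M N K)

end Coupling

end SmallGain

namespace SmallGain

open Matrix
open scoped ComplexOrder

/-! Write α_ij, β_il, τ_i for the H∞ gains to z_i from z_j through M_ij, from u_l through K_il, and
from w_i directly. Each Y₂₂ is chosen through its inverse X = ∑_j a_j M_ij M_ijᵀ + ∑_l b_l K_il
K_ilᵀ + ηI, a form that can be estimated from both sides. With T the transfer function of subsystem
i and φ = e_i/d_i, the largest eigenvalue of φ T X T* is at most φ(∑_j a_j α_ij² + ∑_l b_l β_il² +
ητ_i²). Dually, wᵀX⁻¹w ≤ ∑_j |z_j|²/a_j + ∑_l |u_l|²/b_l whenever w = ∑_j M_ij z_j + ∑_l K_il u_l.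
Take a_j = d_j/(α_ij e_i) and b_l = f_l/(β_il e_i), with the gains enlarged by a small η. Then Fd +
Gf < 0 makes the first bound less than 1. The second bound, summed over i and combined with |Nz|² ≤
∑_j (Hᵀg)_j |z_j|²/d_j (Cauchy–Schwarz and Hd ≤ g), yields the coupling condition from Fᵀe + Hᵀg < 0
and Gᵀe < δ²f. This is `exists_supply_rates`, resting on `exists_supply_of_gain_bound`.

The frequency bound becomes a strict matrix inequality by the Kalman–Yakubovich–Popov lemma
(`exists_storage_of_frequency_condition`): if no storage matrix existed, Hahn–Banach would give a
nonzero dual certificate WWᵀ, and W splits into vectors on which the frequency condition forces the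
wrong sign. The storage matrix is positive by Lyapunov's theorem, since the subsystem is Hurwitz.

Adding the strict local inequalities and the coupling inequality at the worst input u = δ⁻²BᵀPx
gives the Riccati inequality (`riccati_form_neg`); stability and the strict norm bound follow from
it. -/

theorem PosDef.transpose_eq {a : Type*} {P : Matrix a a ℝ} (hP : P.PosDef) : Pᵀ = P := by
  have := hP.isHermitian
  rwa [IsHermitian, conjTranspose_eq_transpose_of_trivial] at this

/-! ### The strict Kalman–Yakubovich–Popov lemma by duality -/

/-- A Hermitian matrix has a Hermitian generalized inverse that commutes with it. -/
theorem exists_hermitian_pseudoinverse {m : Type*} [Fintype m] [DecidableEq m]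
    {H : Matrix m m ℂ} (hH : H.IsHermitian) :
    ∃ G : Matrix m m ℂ, Gᴴ = G ∧ H * G * H = H ∧ G * H * G = G ∧ H * G = G * H := by
  set V : Matrix m m ℂ := (hH.eigenvectorUnitary : Matrix m m ℂ) with hV
  have hVV : Vᴴ * V = 1 := Unitary.coe_star_mul_self hH.eigenvectorUnitary
  set D : Matrix m m ℂ := diagonal fun i => (hH.eigenvalues i : ℂ) with hD
  -- As `0⁻¹ = 0`, inverting eigenvalue by eigenvalue gives the Moore–Penrose inverse.
  set D' : Matrix m m ℂ := diagonal fun i => ((hH.eigenvalues i)⁻¹ : ℂ) with hD'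
  have hHD : H = V * D * Vᴴ := by
    have := hH.spectral_theorem
    rwa [Unitary.conjStarAlgAut_apply] at this
  have h1 : D * D' * D = D := by
    simp only [hD, hD', diagonal_mul_diagonal]
    congr 1; ext i
    exact mul_inv_mul_cancel _
  have h2 : D' * D * D' = D' := by
    simp only [hD, hD', diagonal_mul_diagonal]
    congr 1; ext i
    by_cases h0 : (hH.eigenvalues i : ℂ) = 0 <;> simp [h0]
  have h3 : D * D' = D' * D := by
    simp only [hD, hD', diagonal_mul_diagonal]
    congr 1; ext i
    exact mul_comm _ _
  have h4 : D'ᴴ = D' := by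
    rw [hD', diagonal_conjTranspose]
    congr 1; ext i
    simp
  have key : ∀ P Q : Matrix m m ℂ, (V * P * Vᴴ) * (V * Q * Vᴴ) = V * (P * Q) * Vᴴ := by
    intro P Q
    calc _ = V * P * (Vᴴ * V) * Q * Vᴴ := by simp only [Matrix.mul_assoc]
      _ = _ := by rw [hVV, Matrix.mul_one]; simp only [Matrix.mul_assoc]
  refine ⟨V * D' * Vᴴ, ?_, ?_, ?_, ?_⟩
  · simp [conjTranspose_mul, h4, Matrix.mul_assoc]
  · rw [hHD, key, key, h1]
  · rw [hHD, key, key, h2]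
  · rw [hHD, key, key, h3]

/-- If `X Yᴴ` is skew-Hermitian, then `Y` agrees with `X S`, for a skew-Hermitian `S`, on the
range of an orthogonal projection `Q` whose kernel lies in the kernel of `X`. -/
theorem exists_skew_factor {a m : Type*} [Fintype a] [Fintype m] [DecidableEq m]
    (X Y : Matrix a m ℂ) (h : X * Yᴴ + Y * Xᴴ = 0) :
    ∃ Q S : Matrix m m ℂ, Qᴴ = Q ∧ Q * Q = Q ∧ X * Q = X ∧ Sᴴ = -S ∧ X * S = Y * Q := by
  obtain ⟨G, hG, hHGH, hGHG, hc⟩ :=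
    exists_hermitian_pseudoinverse (isHermitian_conjTranspose_mul_self X)
  set H := Xᴴ * X with hH
  have hHh : Hᴴ = H := isHermitian_conjTranspose_mul_self X
  have hYX : Y * Xᴴ = -(X * Yᴴ) := eq_neg_of_add_eq_zero_right h
  have hXQ : X * (H * G) = X := by
    have h0 : (X * (H * G) - X)ᴴ * (X * (H * G) - X) = 0 := by
      have : (X * (H * G) - X)ᴴ * (X * (H * G) - X)
          = (G * H) * H * (H * G) - (G * H) * H - H * (H * G) + H := by
        simp only [conjTranspose_sub, conjTranspose_mul, hG, hH, Matrix.mul_sub,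
          Matrix.sub_mul, conjTranspose_conjTranspose, Matrix.mul_assoc]
        abel
      have hGHH : G * H * H = H := by rw [← hc, hHGH]
      rw [this, hGHH]
      abel
    exact sub_eq_zero.mp (conjTranspose_mul_self_eq_zero.mp h0)
  have hQX : (H * G) * Xᴴ = Xᴴ := by
    have := congrArg conjTranspose hXQ
    rwa [conjTranspose_mul, conjTranspose_mul, hG, hHh, ← hc] at this
  have hS : (G * (Xᴴ * Y) * (H * G))ᴴ = H * G * (Yᴴ * X) * G := by
    simp only [conjTranspose_mul, hG, hHh, conjTranspose_conjTranspose, Matrix.mul_assoc]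
    rw [← Matrix.mul_assoc G H, ← hc, Matrix.mul_assoc]
  -- Here G Xᴴ is the pseudoinverse of X and Q = H G projects onto the range of Xᴴ, so S is X⁺ Y Q.
  -- Skewness turns Y Q into -X Yᴴ X G, whose columns lie in the range of X and are therefore fixed
  -- by the projection X G Xᴴ.
  refine ⟨H * G, G * (Xᴴ * Y) * (H * G), ?_, ?_, hXQ, ?_, ?_⟩
  · rw [conjTranspose_mul, hG, hHh, hc]
  · rw [← Matrix.mul_assoc, hHGH]
  · rw [hS]
    have e1 : G * (Xᴴ * Y) * (H * G) = G * Xᴴ * (Y * Xᴴ) * X * G := by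
      simp only [hH, Matrix.mul_assoc]
    have e2 : H * G * (Yᴴ * X) * G = G * Xᴴ * (X * Yᴴ) * X * G := by
      rw [hc]; simp only [hH, Matrix.mul_assoc]
    rw [e1, e2, hYX]
    simp only [Matrix.mul_neg, Matrix.neg_mul, neg_neg]
  · have e1 : Y * (H * G) = -(X * Yᴴ * X * G) := by
      have : Y * (H * G) = Y * Xᴴ * X * G := by simp only [hH, Matrix.mul_assoc]
      rw [this, hYX]; simp only [Matrix.neg_mul]
    have e2 : X * (G * (Xᴴ * Y) * (H * G)) = X * G * Xᴴ * (Y * (H * G)) := by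
      simp only [Matrix.mul_assoc]
    have e3 : X * G * Xᴴ * X = X := by
      rw [Matrix.mul_assoc, ← hH, Matrix.mul_assoc, ← hc, hXQ]
    rw [e2, e1, Matrix.mul_neg]
    congr 1
    simp only [← Matrix.mul_assoc]
    rw [e3]

/-- The diagonal entries of `Vᴴ K V` are the values of the form `K` at the columns of `V`. -/
theorem trace_conjTranspose_mul_mul {R m p : Type*} [CommRing R] [StarRing R] [Fintype m]
    [Fintype p] (V : Matrix m p R) (K : Matrix m m R) :
    (Vᴴ * K * V).trace = ∑ k, star (V.col k) ⬝ᵥ (K *ᵥ V.col k) := by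
  simp only [trace, diag_apply]
  refine Finset.sum_congr rfl fun k _ => ?_
  rw [Matrix.mul_assoc, Matrix.mul_apply]
  rfl

/-- Dual step of the Kalman–Yakubovich–Popov lemma: a quadratic form that is negative on all
vectors `ζ` with `F ζ = i ω E ζ` or `E ζ = 0` has negative trace against each nonzero `W Wᴴ`
for which `(E W) (F W)ᴴ` is skew-Hermitian. -/
theorem trace_neg_of_frequency_condition {a m p : Type*} [Fintype a] [Fintype m] [Fintype p]
    [DecidableEq p]
    (E F : Matrix a m ℂ) (K : Matrix m m ℂ)
    (hK : ∀ ζ : m → ℂ, ζ ≠ 0 →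
      ((∃ ω : ℝ, F *ᵥ ζ = (Complex.I * ω) • (E *ᵥ ζ)) ∨ E *ᵥ ζ = 0) →
      (star ζ ⬝ᵥ (K *ᵥ ζ)).re < 0)
    (W : Matrix m p ℂ) (hW : W ≠ 0)
    (hEF : (E * W) * (F * W)ᴴ + (F * W) * (E * W)ᴴ = 0) :
    (Wᴴ * K * W).trace.re < 0 := by
  obtain ⟨Q, S, hQ, hQQ, hXQ, hS, hXS⟩ := exists_skew_factor (E * W) (F * W) hEF
  have hherm : (Complex.I • S).IsHermitian := by
    rw [IsHermitian, conjTranspose_smul, hS]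
    simp
  set V : Matrix p p ℂ := (hherm.eigenvectorUnitary : Matrix p p ℂ) with hV
  have hVV : V * Vᴴ = 1 := Unitary.coe_mul_star_self hherm.eigenvectorUnitary
  -- A skew-Hermitian matrix has an orthonormal eigenbasis with purely imaginary eigenvalues; these
  -- supply the frequencies ω.
  have hcol : ∀ k, S *ᵥ V.col k = (Complex.I * ((-hherm.eigenvalues k : ℝ) : ℂ)) • V.col k := by
    intro k
    have := hherm.mulVec_eigenvectorBasis k
    have h2 : S *ᵥ V.col k = (-Complex.I) • ((Complex.I • S) *ᵥ V.col k) := by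
      rw [smul_mulVec, smul_smul]; simp
    rw [h2, hV, hherm.eigenvectorUnitary_col_eq, this]
    ext j
    simp
    ring
  have hnonpos : ∀ ζ : m → ℂ,
      ((∃ ω : ℝ, F *ᵥ ζ = (Complex.I * ω) • (E *ᵥ ζ)) ∨ E *ᵥ ζ = 0) →
      (star ζ ⬝ᵥ (K *ᵥ ζ)).re ≤ 0 := by
    intro ζ hζ
    by_cases h0 : ζ = 0
    · simp [h0]
    · exact (hK ζ h0 hζ).le
  -- For S v = iω v: F W Q v = E W S v = iω E W v = iω E W Q v.
  have hadm1 : ∀ k, (∃ ω : ℝ, F *ᵥ (W * Q * V).col k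
      = (Complex.I * ω) • (E *ᵥ (W * Q * V).col k)) := by
    intro k
    have hc : (W * Q * V).col k = (W * Q) *ᵥ V.col k := by
      ext i; rfl
    refine ⟨-hherm.eigenvalues k, ?_⟩
    rw [hc, mulVec_mulVec, mulVec_mulVec, ← Matrix.mul_assoc, ← Matrix.mul_assoc, hXQ, ← hXS,
      ← mulVec_mulVec, hcol, mulVec_smul]
  have hadm2 : ∀ k, E *ᵥ (W * (1 - Q) * V).col k = 0 := by
    intro k
    have hc : (W * (1 - Q) * V).col k = (W * (1 - Q)) *ᵥ V.col k := by
      ext i; rfl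
    rw [hc, mulVec_mulVec, ← Matrix.mul_assoc, Matrix.mul_sub, Matrix.mul_one, hXQ, sub_self,
      zero_mulVec]
  -- The trace of Wᴴ K W splits along the complementary projections Q and 1 - Q, and each part is a
  -- sum of values of the form at admissible vectors.
  have hproj : ∀ R : Matrix p p ℂ, Rᴴ = R → R * R = R →
      ((W * R * V)ᴴ * K * (W * R * V)).trace = (Wᴴ * K * W * R).trace := by
    intro R hR hRR
    calc ((W * R * V)ᴴ * K * (W * R * V)).trace
        = (Vᴴ * (R * (Wᴴ * K * W) * R * V)).trace := by
          simp only [conjTranspose_mul, hR, Matrix.mul_assoc]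
      _ = (R * (Wᴴ * K * W) * R * (V * Vᴴ)).trace := by
          rw [trace_mul_comm]; simp only [Matrix.mul_assoc]
      _ = (Wᴴ * K * W * (R * R)).trace := by
          rw [hVV, Matrix.mul_one, Matrix.mul_assoc, trace_mul_comm, Matrix.mul_assoc]
      _ = _ := by rw [hRR]
  have hQ' : (1 - Q)ᴴ = 1 - Q := by simp [hQ]
  have hQQ' : (1 - Q) * (1 - Q) = 1 - Q := by
    simp [Matrix.mul_sub, Matrix.sub_mul, hQQ]
  have hsum : (Wᴴ * K * W).trace
      = ∑ k, star ((W * Q * V).col k) ⬝ᵥ (K *ᵥ (W * Q * V).col k)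
        + ∑ k, star ((W * (1 - Q) * V).col k) ⬝ᵥ (K *ᵥ (W * (1 - Q) * V).col k) := by
    rw [← trace_conjTranspose_mul_mul, ← trace_conjTranspose_mul_mul, hproj Q hQ hQQ,
      hproj _ hQ' hQQ', ← trace_add, ← Matrix.mul_add, add_sub_cancel, Matrix.mul_one]
  have hex : (∃ k, (W * Q * V).col k ≠ 0) ∨ (∃ k, (W * (1 - Q) * V).col k ≠ 0) := by
    by_contra hcon
    push Not at hcon
    have z1 : W * Q * V = 0 := by
      ext i k; exact congrFun (hcon.1 k) i
    have z2 : W * (1 - Q) * V = 0 := by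
      ext i k; exact congrFun (hcon.2 k) i
    apply hW
    calc W = (W * Q * V + W * (1 - Q) * V) * Vᴴ := by
          rw [← Matrix.add_mul, ← Matrix.mul_add, add_sub_cancel, Matrix.mul_one, Matrix.mul_assoc,
            hVV, Matrix.mul_one]
      _ = 0 := by rw [z1, z2]; simp
  rw [hsum, Complex.add_re, Complex.re_sum, Complex.re_sum]
  have n1 : ∀ k, (star ((W * Q * V).col k) ⬝ᵥ (K *ᵥ (W * Q * V).col k)).re ≤ 0 :=
    fun k => hnonpos _ (Or.inl (hadm1 k))
  have n2 : ∀ k, (star ((W * (1 - Q) * V).col k) ⬝ᵥ (K *ᵥ (W * (1 - Q) * V).col k)).re ≤ 0 :=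
    fun k => hnonpos _ (Or.inr (hadm2 k))
  rcases hex with ⟨k, hk⟩ | ⟨k, hk⟩
  · exact add_neg_of_neg_of_nonpos
      (Finset.sum_neg' (fun i _ => n1 i) ⟨k, Finset.mem_univ _, hK _ hk (Or.inl (hadm1 k))⟩)
      (Finset.sum_nonpos fun i _ => n2 i)
  · exact add_neg_of_nonpos_of_neg (Finset.sum_nonpos fun i _ => n1 i)
      (Finset.sum_neg' (fun i _ => n2 i) ⟨k, Finset.mem_univ _, hK _ hk (Or.inr (hadm2 k))⟩)

theorem conjTranspose_map_ofReal {p q : Type*} (X : Matrix p q ℝ) :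
    (X.map ((↑) : ℝ → ℂ))ᴴ = Xᵀ.map ((↑) : ℝ → ℂ) := by
  ext i j
  simp

/-- The real matrices with negative quadratic form form an open set. -/
theorem isOpen_setOf_quadratic_neg {m : Type*} [Fintype m] :
    IsOpen {N : Matrix m m ℝ | ∀ v : m → ℝ, v ≠ 0 → v ⬝ᵥ (N *ᵥ v) < 0} := by
  -- By homogeneity it is enough to test unit vectors, and compactness of the sphere then makes one
  -- neighbourhood of N work for all of them.
  have hset : {N : Matrix m m ℝ | ∀ v : m → ℝ, v ≠ 0 → v ⬝ᵥ (N *ᵥ v) < 0}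
      = {N | ∀ v ∈ Metric.sphere (0 : m → ℝ) 1, v ⬝ᵥ (N *ᵥ v) < 0} := by
    ext N
    constructor
    · intro h v hv
      exact h v (ne_zero_of_mem_unit_sphere (⟨v, hv⟩ : Metric.sphere (0 : m → ℝ) 1))
    · intro h v hv
      have hn : 0 < ‖v‖ := norm_pos_iff.mpr hv
      have := h (‖v‖⁻¹ • v) (by simp [norm_smul, hn.ne'])
      rw [mulVec_smul, smul_dotProduct, dotProduct_smul, smul_eq_mul, smul_eq_mul] at this
      by_contra hcon
      push Not at hcon
      exact absurd this (not_lt.mpr (by positivity))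
  rw [hset, isOpen_iff_mem_nhds]
  intro N hN
  refine (isCompact_sphere (0 : m → ℝ) 1).eventually_forall_of_forall_eventually
    (P := fun (N : Matrix m m ℝ) v => v ⬝ᵥ (N *ᵥ v) < 0) fun v hv => ?_
  have hc : Continuous fun z : Matrix m m ℝ × (m → ℝ) => z.2 ⬝ᵥ (z.1 *ᵥ z.2) := by fun_prop
  exact hc.continuousAt.eventually_lt continuousAt_const (hN v hv)

/-- A functional on real square matrices that takes values below `u` on the matrices with
negative quadratic form is nonnegative on the rank one matrices `v vᵀ`, and `0 ≤ u`. -/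
theorem nonneg_of_lt_on_quadratic_neg {m : Type*} [Fintype m] [DecidableEq m]
    (f : Matrix m m ℝ →ₗ[ℝ] ℝ) (u : ℝ)
    (hf : ∀ N : Matrix m m ℝ, (∀ v : m → ℝ, v ≠ 0 → v ⬝ᵥ (N *ᵥ v) < 0) → f N < u) :
    0 ≤ u ∧ ∀ v : m → ℝ, 0 ≤ f (vecMulVec v v) := by
  -- The negative forms are a cone, so an upper bound u on it improves to 0.
  have hcone : ∀ N : Matrix m m ℝ, (∀ v : m → ℝ, v ≠ 0 → v ⬝ᵥ (N *ᵥ v) < 0) → f N ≤ 0 := by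
    intro N hN
    by_contra hcon
    push Not at hcon
    have := hf (((|u| + 1) / f N) • N) (by
      intro v hv
      rw [smul_mulVec, dotProduct_smul, smul_eq_mul]
      exact mul_neg_of_pos_of_neg (by positivity) (hN v hv))
    rw [map_smul, smul_eq_mul, div_mul_cancel₀ _ hcon.ne'] at this
    linarith [le_abs_self u]
  have hdot : ∀ v : m → ℝ, v ≠ 0 → 0 < v ⬝ᵥ v := by
    intro v hv
    have := dotProduct_star_self_pos_iff.mpr hv
    simpa using this
  have hone : ∀ t : ℝ, 0 < t → ∀ v : m → ℝ, v ≠ 0 →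
      v ⬝ᵥ ((-(t • (1 : Matrix m m ℝ))) *ᵥ v) < 0 := by
    intro t ht v hv
    rw [neg_mulVec, smul_mulVec, one_mulVec, dotProduct_neg, dotProduct_smul, smul_eq_mul]
    have := mul_pos ht (hdot v hv)
    linarith
  have hone0 : 0 ≤ f 1 := by
    have := hcone _ (hone 1 one_pos)
    rw [map_neg, map_smul, one_smul] at this
    linarith
  constructor
  · by_contra hcon
    push Not at hcon
    have h1 : ∀ t : ℝ, 0 < t → -(t * f 1) < u := by
      intro t ht
      have := hf _ (hone t ht)
      rwa [map_neg, map_smul, smul_eq_mul] at this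
    have h2 := h1 (-u / (f 1 + 1)) (by apply div_pos <;> linarith)
    have h3 : -u / (f 1 + 1) * f 1 ≤ -u := by
      rw [div_mul_eq_mul_div, div_le_iff₀ (by linarith)]
      nlinarith
    linarith
  · intro v
    -- The matrix -vvᵀ is only semidefinite, so it is approached by -tI - vvᵀ; a small explicit t
    -- replaces the limit t → 0.
    have h1 : ∀ t : ℝ, 0 < t → -(t * f 1) ≤ f (vecMulVec v v) := by
      intro t ht
      have := hcone (-(t • (1 : Matrix m m ℝ)) - vecMulVec v v) (by
        intro w hw
        rw [sub_mulVec, dotProduct_sub, vecMulVec_mulVec]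
        have := hone t ht w hw
        have h2 : w ⬝ᵥ (MulOpposite.op (v ⬝ᵥ w) • v) = (v ⬝ᵥ w) ^ 2 := by
          rw [op_smul_eq_smul, dotProduct_smul, smul_eq_mul, dotProduct_comm w v, sq]
        rw [h2]
        nlinarith [sq_nonneg (v ⬝ᵥ w)])
      rw [map_sub, map_neg, map_smul, smul_eq_mul] at this
      linarith
    by_contra hcon
    push Not at hcon
    have h2 := h1 (-f (vecMulVec v v) / (2 * (f 1 + 1))) (by apply div_pos <;> linarith)
    have h3 : -f (vecMulVec v v) / (2 * (f 1 + 1)) * f 1 ≤ -f (vecMulVec v v) / 2 := by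
      rw [div_mul_eq_mul_div, div_le_iff₀ (by linarith)]
      nlinarith
    linarith

/-- On symmetric matrices a linear functional is the trace pairing with a symmetric matrix. -/
theorem exists_symm_trace_repr {m : Type*} [Fintype m] [DecidableEq m]
    (f : Matrix m m ℝ →ₗ[ℝ] ℝ) :
    ∃ Z : Matrix m m ℝ, Zᵀ = Z ∧ ∀ N : Matrix m m ℝ, Nᵀ = N → f N = (Z * N).trace := by
  refine ⟨Matrix.of fun i j => (f (single i j 1) + f (single j i 1)) / 2, ?_, ?_⟩
  · ext i j
    simp [add_comm]
  · intro N hN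
    have hsum : ∀ N : Matrix m m ℝ, f N = ∑ i, ∑ j, N i j * f (single i j 1) := by
      intro N
      conv_lhs => rw [matrix_eq_sum_single N]
      simp only [map_sum]
      refine Finset.sum_congr rfl fun i _ => Finset.sum_congr rfl fun j _ => ?_
      rw [← smul_eq_mul, ← map_smul, smul_single, smul_eq_mul, mul_one]
    have hsym : ∀ i j, N i j = N j i := fun i j => congrFun (congrFun hN j) i
    have hsum2 : f N = ∑ i, ∑ j, N i j * f (single j i 1) := by
      rw [hsum N, Finset.sum_comm]
      refine Finset.sum_congr rfl fun i _ => Finset.sum_congr rfl fun j _ => ?_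
      rw [hsym]
    simp only [trace, diag_apply, Matrix.mul_apply, of_apply]
    have : f N = (f N + f N) / 2 := by ring
    rw [this]
    nth_rewrite 1 [hsum N]
    rw [hsum2, ← Finset.sum_add_distrib, Finset.sum_div]
    refine Finset.sum_congr rfl fun i _ => ?_
    rw [← Finset.sum_add_distrib, Finset.sum_div]
    refine Finset.sum_congr rfl fun j _ => ?_
    rw [hsym j i]
    ring

open scoped MatrixOrder Matrix.Norms.L2Operator in
theorem PosSemidef.exists_eq_mul_transpose {m : Type*} [Fintype m] [DecidableEq m]
    {Z : Matrix m m ℝ} (hZ : Z.PosSemidef) : ∃ W : Matrix m m ℝ, Z = W * Wᵀ := by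
  obtain ⟨b, hb⟩ := CStarAlgebra.nonneg_iff_eq_star_mul_self.mp hZ.nonneg
  refine ⟨bᵀ, ?_⟩
  rw [hb, transpose_transpose, star_eq_conjTranspose, conjTranspose_eq_transpose_of_trivial]

/-- **Kalman–Yakubovich–Popov lemma** (strict version). If the quadratic form of the real
symmetric matrix `K` is negative on all nonzero complex vectors `ζ` with `F ζ = i ω E ζ` for some
`ω ∈ ℝ`, or `E ζ = 0`, then `K + Eᵀ P F + Fᵀ P E ≺ 0` for some symmetric `P`. -/
theorem exists_storage_of_frequency_condition {a m : Type*} [Fintype a] [Fintype m]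
    [DecidableEq m] (E F : Matrix a m ℝ) (K : Matrix m m ℝ) (hKs : Kᵀ = K)
    (hK : ∀ ζ : m → ℂ, ζ ≠ 0 →
      ((∃ ω : ℝ, F.map ((↑) : ℝ → ℂ) *ᵥ ζ = (Complex.I * ω) • (E.map ((↑) : ℝ → ℂ) *ᵥ ζ))
        ∨ E.map ((↑) : ℝ → ℂ) *ᵥ ζ = 0) →
      (star ζ ⬝ᵥ (K.map ((↑) : ℝ → ℂ) *ᵥ ζ)).re < 0) :
    ∃ P : Matrix a a ℝ, Pᵀ = P ∧
      ∀ v : m → ℝ, v ≠ 0 → v ⬝ᵥ ((K + Eᵀ * P * F + Fᵀ * P * E) *ᵥ v) < 0 := by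
  by_contra hcon
  push Not at hcon
  -- Separate the open cone of negative forms from the affine family K + EᵀPF + FᵀPE, which misses
  -- it by assumption.
  obtain ⟨f, u, hfs, hft⟩ := geometric_hahn_banach_open
    (s := {N : Matrix m m ℝ | ∀ v : m → ℝ, v ≠ 0 → v ⬝ᵥ (N *ᵥ v) < 0})
    (t := {N | ∃ P : Matrix a a ℝ, Pᵀ = P ∧ N = K + Eᵀ * P * F + Fᵀ * P * E})
    (by
      intro N hN N' hN' s t hs ht hst v hv
      rw [add_mulVec, smul_mulVec, smul_mulVec, dotProduct_add, dotProduct_smul, dotProduct_smul,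
        smul_eq_mul, smul_eq_mul]
      have h1 := hN v hv
      have h2 := hN' v hv
      rcases hs.eq_or_lt with rfl | hs
      · rw [zero_add] at hst
        subst hst
        linarith
      · nlinarith)
    isOpen_setOf_quadratic_neg
    (by
      rintro _ ⟨P, hP, rfl⟩ _ ⟨P', hP', rfl⟩ s t hs ht hst
      refine ⟨s • P + t • P', by simp [hP, hP'], ?_⟩
      have : K = s • K + t • K := by rw [← add_smul, hst, one_smul]
      conv_rhs => rw [this]
      simp only [smul_add, Matrix.mul_add, Matrix.add_mul, Matrix.mul_smul, Matrix.smul_mul]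
      abel)
    (by
      rw [Set.disjoint_left]
      rintro N hN ⟨P, hP, rfl⟩
      obtain ⟨v, hv, hv'⟩ := hcon P hP
      exact absurd (hN v hv) (not_lt.mpr hv'))
  obtain ⟨hu, hvv⟩ := nonneg_of_lt_on_quadratic_neg (f : Matrix m m ℝ →ₗ[ℝ] ℝ) u hfs
  obtain ⟨Z, hZs, hZf⟩ := exists_symm_trace_repr (f : Matrix m m ℝ →ₗ[ℝ] ℝ)
  simp only [ContinuousLinearMap.coe_coe] at hvv hZf
  have hsymm : ∀ P : Matrix a a ℝ, Pᵀ = P →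
      (Eᵀ * P * F + Fᵀ * P * E)ᵀ = Eᵀ * P * F + Fᵀ * P * E := by
    intro P hP
    simp only [transpose_add, transpose_mul, transpose_transpose, hP, Matrix.mul_assoc]
    rw [add_comm]
  have hge : ∀ P : Matrix a a ℝ, Pᵀ = P → u ≤ f K + f (Eᵀ * P * F + Fᵀ * P * E) := by
    intro P hP
    rw [← map_add, ← add_assoc]
    exact hft _ ⟨P, hP, rfl⟩
  have hK0 : u ≤ f K := by simpa using hge 0 (by simp)
  -- A functional bounded below on a linear space vanishes there; the scaling chosen would bring the
  -- value down to -1 < u.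
  have hLP : ∀ P : Matrix a a ℝ, Pᵀ = P → f (Eᵀ * P * F + Fᵀ * P * E) = 0 := by
    intro P hP
    by_contra hne
    have h1 := hge ((-(f K + 1) / f (Eᵀ * P * F + Fᵀ * P * E)) • P) (by simp [hP])
    rw [Matrix.mul_smul, Matrix.mul_smul, Matrix.smul_mul, Matrix.smul_mul, ← smul_add, map_smul,
      smul_eq_mul, div_mul_cancel₀ _ hne] at h1
    linarith
  have hZ : Z.PosSemidef := by
    refine PosSemidef.of_dotProduct_mulVec_nonneg ?_ fun v => ?_
    · rw [IsHermitian, conjTranspose_eq_transpose_of_trivial, hZs]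
    · have h1 := hvv v
      rw [hZf _ (transpose_vecMulVec v v), mul_vecMulVec, trace_vecMulVec, dotProduct_comm] at h1
      simpa using h1
  have hZ0 : Z ≠ 0 := by
    rintro rfl
    have h1 : f (-1) < u := hfs (-1) (by
      intro v hv
      have := dotProduct_star_self_pos_iff.mpr hv
      simpa [neg_mulVec] using this)
    rw [hZf _ (by simp)] at h1
    rw [hZf _ hKs] at hK0
    simp at h1 hK0
    linarith
  obtain ⟨W, rfl⟩ := PosSemidef.exists_eq_mul_transpose hZ
  have hW0 : W ≠ 0 := by
    rintro rfl
    simp at hZ0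
  set c : ℝ →+* ℂ := Complex.ofRealHom with hc
  -- Testing the vanishing functional on P = R itself gives tr(RᵀR) = 0, hence R = 0.
  have hskew : (E * W) * (F * W)ᵀ + (F * W) * (E * W)ᵀ = 0 := by
    set R := (E * W) * (F * W)ᵀ + (F * W) * (E * W)ᵀ with hR
    have hRs : Rᵀ = R := by
      rw [hR]
      simp only [transpose_add, transpose_mul, transpose_transpose]
      rw [add_comm]
    have h1 := hLP R hRs
    rw [hZf _ (hsymm R hRs), Matrix.mul_add, trace_add] at h1
    have h2 : (W * Wᵀ * (Eᵀ * R * F)).trace = (R * ((F * W) * (E * W)ᵀ)).trace := by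
      rw [trace_mul_comm R, transpose_mul]
      rw [show W * Wᵀ * (Eᵀ * R * F) = (W * Wᵀ * Eᵀ * R) * F by simp only [Matrix.mul_assoc],
        trace_mul_comm]
      simp only [Matrix.mul_assoc]
    have h3 : (W * Wᵀ * (Fᵀ * R * E)).trace = (R * ((E * W) * (F * W)ᵀ)).trace := by
      rw [trace_mul_comm R, transpose_mul]
      rw [show W * Wᵀ * (Fᵀ * R * E) = (W * Wᵀ * Fᵀ * R) * E by simp only [Matrix.mul_assoc],
        trace_mul_comm]
      simp only [Matrix.mul_assoc]
    rw [h2, h3, ← trace_add, ← Matrix.mul_add, add_comm, ← hR] at h1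
    nth_rewrite 1 [← hRs] at h1
    rwa [← conjTranspose_eq_transpose_of_trivial, trace_conjTranspose_mul_self_eq_zero_iff] at h1
  have hconj : ∀ X : Matrix a m ℝ, (X.map c)ᴴ = Xᵀ.map c := conjTranspose_map_ofReal
  -- The certificate then satisfies tr(WᵀKW) < 0, while separation gives tr(WᵀKW) = f K ≥ u ≥ 0.
  have hneg := trace_neg_of_frequency_condition (E.map c) (F.map c) (K.map c) hK (W.map c)
    (by
      intro h0
      apply hW0
      ext i j
      have := congrFun (congrFun h0 i) j
      simpa [hc] using this)
    (by
      rw [← Matrix.map_mul, ← Matrix.map_mul, hconj, hconj, ← Matrix.map_mul, ← Matrix.map_mul,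
        ← Matrix.map_add c (map_add c), hskew]
      simp)
  have htr : ((W.map c)ᴴ * K.map c * W.map c).trace = c (f K) := by
    rw [show (W.map c)ᴴ = Wᵀ.map c from conjTranspose_map_ofReal W, ← Matrix.map_mul,
      ← Matrix.map_mul, hZf _ hKs]
    rw [show W * Wᵀ * K = W * (Wᵀ * K) by simp only [Matrix.mul_assoc], trace_mul_comm W]
    exact (AddMonoidHom.map_trace (c : ℝ →+ ℂ) _).symm
  rw [htr] at hneg
  simp only [hc, Complex.ofRealHom_eq_coe, Complex.ofReal_re] at hneg
  linarith

/-! ### Euclidean norms and maximal singular values -/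

section SqNorm

variable {𝕜 : Type*} [RCLike 𝕜] {a b : Type*} [Fintype a] [Fintype b]

/-- The square of the Euclidean norm of a vector. -/
noncomputable def sqNorm (v : a → 𝕜) : ℝ := ∑ i, ‖v i‖ ^ 2

theorem sqNorm_nonneg (v : a → 𝕜) : 0 ≤ sqNorm v :=
  Finset.sum_nonneg fun _ _ => by positivity

theorem sqNorm_eq_norm_sq (v : a → 𝕜) : sqNorm v = ‖WithLp.toLp 2 v‖ ^ 2 := by
  rw [EuclideanSpace.norm_sq_eq, sqNorm]

theorem star_dotProduct_self (v : a → 𝕜) : star v ⬝ᵥ v = (sqNorm v : 𝕜) := by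
  simp only [dotProduct, sqNorm, Pi.star_apply, RCLike.star_def, RCLike.conj_mul]
  push_cast
  rfl

theorem dotProduct_self_eq_sqNorm (v : a → ℝ) : v ⬝ᵥ v = sqNorm v := by
  simpa using star_dotProduct_self v

open scoped Matrix.Norms.L2Operator in
theorem sigmaMax_nonneg [DecidableEq b] (X : Matrix a b 𝕜) : 0 ≤ sigmaMax X := norm_nonneg X

open scoped Matrix.Norms.L2Operator in
theorem sqNorm_mulVec_le [DecidableEq b] (X : Matrix a b 𝕜) (v : b → 𝕜) :
    sqNorm (X *ᵥ v) ≤ sigmaMax X ^ 2 * sqNorm v := by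
  rw [sqNorm_eq_norm_sq, sqNorm_eq_norm_sq, ← mul_pow]
  exact pow_le_pow_left₀ (norm_nonneg _) (l2_opNorm_mulVec X (WithLp.toLp 2 v)) 2

open scoped Matrix.Norms.L2Operator in
theorem sigmaMax_le [DecidableEq b] {X : Matrix a b 𝕜} {c : ℝ} (hc : 0 ≤ c)
    (h : ∀ v, sqNorm (X *ᵥ v) ≤ c ^ 2 * sqNorm v) : sigmaMax X ≤ c := by
  rw [sigmaMax, l2_opNorm_def]
  refine ContinuousLinearMap.opNorm_le_bound _ hc fun v => ?_
  have h1 := h v.ofLp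
  rw [sqNorm_eq_norm_sq, sqNorm_eq_norm_sq, ← mul_pow] at h1
  exact le_of_sq_le_sq h1 (by positivity)

open scoped Matrix.Norms.L2Operator in
theorem sigmaMax_conjTranspose [DecidableEq a] [DecidableEq b] (X : Matrix a b 𝕜) :
    sigmaMax Xᴴ = sigmaMax X := l2_opNorm_conjTranspose X

theorem star_mulVec_dotProduct (X : Matrix a b 𝕜) (v : b → 𝕜) (w : a → 𝕜) :
    star (X *ᵥ v) ⬝ᵥ w = star v ⬝ᵥ (Xᴴ *ᵥ w) := by
  rw [star_mulVec, dotProduct_mulVec]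

end SqNorm

/-! ### Real quadratic forms at complex vectors -/

section RealForms

theorem map_ofReal_mul {a b c : Type*} [Fintype b] (X : Matrix a b ℝ) (Y : Matrix b c ℝ) :
    (X * Y).map ((↑) : ℝ → ℂ) = X.map ((↑) : ℝ → ℂ) * Y.map ((↑) : ℝ → ℂ) :=
  Matrix.map_mul (f := Complex.ofRealHom)

theorem map_ofReal_add {a b : Type*} (X Y : Matrix a b ℝ) :
    (X + Y).map ((↑) : ℝ → ℂ) = X.map ((↑) : ℝ → ℂ) + Y.map ((↑) : ℝ → ℂ) :=
  Matrix.map_add _ Complex.ofReal_add X Y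

theorem map_ofReal_smul {a b : Type*} (r : ℝ) (X : Matrix a b ℝ) :
    (r • X).map ((↑) : ℝ → ℂ) = (r : ℂ) • X.map ((↑) : ℝ → ℂ) := by
  ext i j
  simp

variable {a b : Type*} [Fintype a] [Fintype b]

/-- The quadratic form of a real matrix at a complex vector splits into real and imaginary part. -/
theorem re_star_dotProduct_map (K : Matrix a a ℝ) (ζ : a → ℂ) :
    (star ζ ⬝ᵥ (K.map ((↑) : ℝ → ℂ) *ᵥ ζ)).re
      = (fun i => (ζ i).re) ⬝ᵥ (K *ᵥ fun i => (ζ i).re)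
        + (fun i => (ζ i).im) ⬝ᵥ (K *ᵥ fun i => (ζ i).im) := by
  simp only [dotProduct, mulVec, Complex.re_sum, ← Finset.sum_add_distrib, Finset.mul_sum]
  refine Finset.sum_congr rfl fun i _ => Finset.sum_congr rfl fun j _ => ?_
  simp

theorem re_form_pos {K : Matrix a a ℝ} (hK : ∀ v : a → ℝ, v ≠ 0 → 0 < v ⬝ᵥ (K *ᵥ v))
    {ζ : a → ℂ} (hζ : ζ ≠ 0) : 0 < (star ζ ⬝ᵥ (K.map ((↑) : ℝ → ℂ) *ᵥ ζ)).re := by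
  rw [re_star_dotProduct_map]
  have h0 : ∀ v : a → ℝ, 0 ≤ v ⬝ᵥ (K *ᵥ v) := by
    intro v
    by_cases hv : v = 0
    · simp [hv]
    · exact (hK v hv).le
  by_cases hre : (fun i => (ζ i).re) = 0
  · refine add_pos_of_nonneg_of_pos (h0 _) (hK _ fun him => hζ ?_)
    ext i
    exact Complex.ext (congrFun hre i) (congrFun him i)
  · exact add_pos_of_pos_of_nonneg (hK _ hre) (h0 _)

theorem re_form_neg {K : Matrix a a ℝ} (hK : ∀ v : a → ℝ, v ≠ 0 → v ⬝ᵥ (K *ᵥ v) < 0)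
    {ζ : a → ℂ} (hζ : ζ ≠ 0) : (star ζ ⬝ᵥ (K.map ((↑) : ℝ → ℂ) *ᵥ ζ)).re < 0 := by
  have h := re_form_pos (K := -K) (fun v hv => by
    rw [neg_mulVec, dotProduct_neg]
    linarith [hK v hv]) hζ
  have hm : (-K).map ((↑) : ℝ → ℂ) = -K.map ((↑) : ℝ → ℂ) := by
    ext i j
    simp
  rw [hm, neg_mulVec, dotProduct_neg, Complex.neg_re] at h
  linarith

/-- The form of `P A + Aᵀ P` at a complex vector. -/
theorem re_lyapunov_form {P : Matrix a a ℝ} (hP : Pᵀ = P) (A : Matrix a a ℝ) (ζ : a → ℂ) :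
    (star ζ ⬝ᵥ ((P * A + Aᵀ * P).map ((↑) : ℝ → ℂ) *ᵥ ζ)).re
      = 2 * (star (P.map ((↑) : ℝ → ℂ) *ᵥ ζ) ⬝ᵥ (A.map ((↑) : ℝ → ℂ) *ᵥ ζ)).re := by
  have h1 : star ζ ⬝ᵥ ((P * A).map ((↑) : ℝ → ℂ) *ᵥ ζ)
      = star (P.map ((↑) : ℝ → ℂ) *ᵥ ζ) ⬝ᵥ (A.map ((↑) : ℝ → ℂ) *ᵥ ζ) := by
    rw [map_ofReal_mul, star_mulVec_dotProduct, conjTranspose_map_ofReal, hP, mulVec_mulVec]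
  have h2 : star ζ ⬝ᵥ ((Aᵀ * P).map ((↑) : ℝ → ℂ) *ᵥ ζ)
      = star (A.map ((↑) : ℝ → ℂ) *ᵥ ζ) ⬝ᵥ (P.map ((↑) : ℝ → ℂ) *ᵥ ζ) := by
    rw [map_ofReal_mul, star_mulVec_dotProduct, conjTranspose_map_ofReal, mulVec_mulVec]
  have h3 : (star (A.map ((↑) : ℝ → ℂ) *ᵥ ζ) ⬝ᵥ (P.map ((↑) : ℝ → ℂ) *ᵥ ζ)).re
      = (star (P.map ((↑) : ℝ → ℂ) *ᵥ ζ) ⬝ᵥ (A.map ((↑) : ℝ → ℂ) *ᵥ ζ)).re := by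
    rw [← Complex.conj_re, ← Complex.star_def, ← star_dotProduct_star, star_star, dotProduct_comm]
  rw [map_ofReal_add, add_mulVec, dotProduct_add, Complex.add_re, h1, h2, h3]
  ring

theorem star_form_im_eq_zero {P : Matrix a a ℝ} (hP : Pᵀ = P) (ζ : a → ℂ) :
    (star (P.map ((↑) : ℝ → ℂ) *ᵥ ζ) ⬝ᵥ ζ).im = 0 := by
  rw [← Complex.conj_eq_iff_im, ← Complex.star_def, ← star_dotProduct_star, star_star,
    star_mulVec_dotProduct, conjTranspose_map_ofReal, hP, dotProduct_comm]

end RealForms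

/-! ### Hurwitz matrices and Lyapunov's theorem -/

section Hurwitz

variable {a b c : Type*} [Fintype a] [DecidableEq a]

theorem IsHurwitz.isUnit_sub {A : Matrix a a ℝ} (hA : IsHurwitz A) {s : ℂ} (hs : 0 ≤ s.re) :
    IsUnit (s • (1 : Matrix a a ℂ) - A.map ((↑) : ℝ → ℂ)) := by
  by_contra h
  refine absurd (hA s ?_) (not_lt.mpr hs)
  rwa [spectrum.mem_iff, Algebra.algebraMap_eq_smul_one]

theorem exists_eigenvector_of_mem_spectrum {A : Matrix a a ℂ} {μ : ℂ} (h : μ ∈ spectrum ℂ A) :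
    ∃ v : a → ℂ, v ≠ 0 ∧ A *ᵥ v = μ • v := by
  rw [spectrum.mem_iff, Algebra.algebraMap_eq_smul_one, isUnit_iff_isUnit_det, isUnit_iff_ne_zero,
    not_not, ← exists_mulVec_eq_zero_iff] at h
  obtain ⟨v, hv, h⟩ := h
  refine ⟨v, hv, ?_⟩
  rw [sub_mulVec, smul_mulVec, one_mulVec, sub_eq_zero] at h
  exact h.symm

-- Gelfand's formula: a spectral radius below r < 1 gives ‖T ^ k‖ ≤ r ^ k for all large k.
open Filter Topology in
theorem tendsto_pow_mulVec_of_spectrum {T : Matrix a a ℂ}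
    (hT : ∀ μ ∈ spectrum ℂ T, ‖μ‖ < 1) (v : a → ℂ) :
    Tendsto (fun k : ℕ => (T ^ k) *ᵥ v) atTop (𝓝 0) := by
  open scoped Matrix.Norms.L2Operator in
  rcases isEmpty_or_nonempty a with ha | ha
  · have : (fun k : ℕ => (T ^ k) *ᵥ v) = fun _ => 0 := by
      ext k i
      exact isEmptyElim i
    rw [this]
    exact tendsto_const_nhds
  have hr : spectralRadius ℂ T < ((1 : NNReal) : ENNReal) :=
    spectrum.spectralRadius_lt_of_forall_lt T fun μ hμ => by
      have := hT μ hμ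
      exact_mod_cast this
  obtain ⟨r, hr1, hr2⟩ := ENNReal.lt_iff_exists_nnreal_btwn.mp hr
  have hr2' : r < 1 := by exact_mod_cast hr2
  have hev := (spectrum.pow_nnnorm_pow_one_div_tendsto_nhds_spectralRadius T).eventually_lt_const hr1
  have hpow : Tendsto (fun k : ℕ => T ^ k) atTop (𝓝 0) := by
    refine squeeze_zero_norm' ?_ (tendsto_pow_atTop_nhds_zero_of_lt_one r.coe_nonneg
      (by exact_mod_cast hr2'))
    filter_upwards [hev, eventually_gt_atTop 0] with k hk hk0
    have h1 : ((‖T ^ k‖₊ : ENNReal) ^ (1 / (k : ℝ))) ^ (k : ℝ) ≤ (r : ENNReal) ^ (k : ℝ) :=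
      ENNReal.rpow_le_rpow hk.le (by positivity)
    rw [← ENNReal.rpow_mul, one_div_mul_cancel (by positivity), ENNReal.rpow_one,
      ENNReal.rpow_natCast] at h1
    have h2 : ‖T ^ k‖₊ ≤ r ^ k := by exact_mod_cast h1
    exact_mod_cast h2
  have hcont : Continuous fun M : Matrix a a ℂ => M *ᵥ v := by fun_prop
  have := (hcont.tendsto 0).comp hpow
  rw [zero_mulVec] at this
  exact this

/-- **Lyapunov's theorem**: a symmetric solution of `P A + Aᵀ P ≺ 0` with `A` Hurwitz is positive
definite. -/
theorem IsHurwitz.posDef_of_lyapunov {A P : Matrix a a ℝ} (hA : IsHurwitz A) (hP : Pᵀ = P)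
    (h : ∀ v : a → ℝ, v ≠ 0 → v ⬝ᵥ ((P * A + Aᵀ * P) *ᵥ v) < 0) : P.PosDef := by
  set Ac := A.map ((↑) : ℝ → ℂ) with hAc
  set Pc := P.map ((↑) : ℝ → ℂ) with hPc
  have hunit : IsUnit ((1 : Matrix a a ℂ) - Ac).det := by
    have := hA.isUnit_sub (s := 1) (by simp)
    rwa [one_smul, isUnit_iff_isUnit_det] at this
  set R := ((1 : Matrix a a ℂ) - Ac)⁻¹ with hR
  -- The Cayley transform carries the left half plane into the unit disc, so powers of T can replace
  -- the flow exp(tA) in Lyapunov's argument.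
  set T := (1 + Ac) * R with hT
  have hR1 : (1 - Ac) * R = 1 := mul_nonsing_inv _ hunit
  set V : (a → ℂ) → ℝ := fun x => (star x ⬝ᵥ (Pc *ᵥ x)).re with hV
  have hx : ∀ x, x = R *ᵥ x - Ac *ᵥ (R *ᵥ x) := by
    intro x
    conv_lhs => rw [← one_mulVec x, ← hR1, ← mulVec_mulVec, sub_mulVec, one_mulVec]
  have hTx : ∀ x, T *ᵥ x = R *ᵥ x + Ac *ᵥ (R *ᵥ x) := by
    intro x
    rw [hT, ← mulVec_mulVec, add_mulVec, one_mulVec]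
  -- With y = R x, one has x = y - Ay and T x = y + Ay, so only the cross terms survive in the
  -- difference.
  have hdiff : ∀ x, V x - V (T *ᵥ x)
      = -2 * (star (R *ᵥ x) ⬝ᵥ ((P * A + Aᵀ * P).map ((↑) : ℝ → ℂ) *ᵥ (R *ᵥ x))).re := by
    intro x
    rw [re_lyapunov_form hP, hTx]
    nth_rewrite 1 [hx x]
    set y := R *ᵥ x
    have h2 : (star (Ac *ᵥ y) ⬝ᵥ (Pc *ᵥ y)).re = (star (Pc *ᵥ y) ⬝ᵥ (Ac *ᵥ y)).re := by
      rw [← Complex.conj_re, ← Complex.star_def, ← star_dotProduct_star, star_star,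
        dotProduct_comm]
    have h3 : star y ⬝ᵥ (Pc *ᵥ (Ac *ᵥ y)) = star (Pc *ᵥ y) ⬝ᵥ (Ac *ᵥ y) := by
      rw [star_mulVec_dotProduct Pc, hPc, conjTranspose_map_ofReal, hP]
    simp only [hV, mulVec_sub, mulVec_add, star_sub, star_add, sub_dotProduct, add_dotProduct,
      dotProduct_sub, dotProduct_add, Complex.sub_re, Complex.add_re, h2, h3]
    ring
  have hstrict : ∀ x, x ≠ 0 → V (T *ᵥ x) < V x := by
    intro x hx0
    have hy : R *ᵥ x ≠ 0 := by
      intro hy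
      apply hx0
      rw [hx x, hy]
      simp
    have := re_form_neg h hy
    have := hdiff x
    linarith
  have hmono : ∀ x, V (T *ᵥ x) ≤ V x := by
    intro x
    by_cases hx0 : x = 0
    · simp [hx0]
    · exact (hstrict x hx0).le
  -- An eigenvalue μ of T comes from the eigenvalue λ = (μ - 1)/(μ + 1) of A, and Re λ has the sign
  -- of |μ|² - 1. The value μ = -1 would force y = 0.
  have hspec : ∀ μ ∈ spectrum ℂ T, ‖μ‖ < 1 := by
    intro μ hμ
    obtain ⟨v, hv, hTv⟩ := exists_eigenvector_of_mem_spectrum hμ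
    rw [hTx] at hTv
    nth_rewrite 3 [hx v] at hTv
    set y := R *ᵥ v with hy
    have hy0 : y ≠ 0 := by
      intro h0
      apply hv
      rw [hx v, ← hy, h0]
      simp
    have e1 : (1 + μ) • (Ac *ᵥ y) = (μ - 1) • y := by
      rw [add_smul, sub_smul, one_smul, one_smul]
      rw [smul_sub] at hTv
      linear_combination (exp := 1) hTv
    have hμ1 : 1 + μ ≠ 0 := by
      intro h0
      rw [h0, zero_smul, eq_comm, smul_eq_zero] at e1
      rcases e1 with e1 | e1
      · have : (2 : ℂ) = 0 := by linear_combination h0 - e1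
        norm_num at this
      · exact hy0 e1
    have e2 : Ac *ᵥ y = ((μ - 1) / (1 + μ)) • y := by
      rw [div_eq_inv_mul, ← smul_smul, ← e1, smul_smul, inv_mul_cancel₀ hμ1, one_smul]
    have hmem : (μ - 1) / (1 + μ) ∈ spectrum ℂ Ac := by
      rw [spectrum.mem_iff, Algebra.algebraMap_eq_smul_one, isUnit_iff_isUnit_det,
        isUnit_iff_ne_zero, not_not, ← exists_mulVec_eq_zero_iff]
      exact ⟨y, hy0, by rw [sub_mulVec, smul_mulVec, one_mulVec, e2, sub_self]⟩
    have hre := hA _ hmem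
    have hn : 0 < Complex.normSq (1 + μ) := Complex.normSq_pos.mpr hμ1
    rw [Complex.div_re, ← add_div, div_lt_iff₀ hn, zero_mul] at hre
    have h4 : Complex.normSq μ < 1 := by
      rw [Complex.normSq_apply]
      simp at hre
      nlinarith
    rw [Complex.normSq_eq_norm_sq] at h4
    nlinarith [norm_nonneg μ]
  -- V decreases along the orbit of T, which tends to 0, so V x is at least the limit V 0 = 0.
  have hVnonneg : ∀ x, 0 ≤ V x := by
    intro x
    have hle : ∀ k : ℕ, V ((T ^ k) *ᵥ x) ≤ V x := by
      intro k
      induction k with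
      | zero => simp
      | succ k ih =>
        rw [pow_succ', ← mulVec_mulVec]
        exact (hmono _).trans ih
    have hcont : Continuous V := by
      simp only [hV]
      fun_prop
    have hlim := (hcont.tendsto 0).comp (tendsto_pow_mulVec_of_spectrum hspec x)
    have hV0 : V 0 = 0 := by simp [hV]
    rw [hV0] at hlim
    exact le_of_tendsto' hlim hle
  refine PosDef.of_dotProduct_mulVec_pos ?_ fun v hv => ?_
  · rw [IsHermitian, conjTranspose_eq_transpose_of_trivial, hP]
  · set ζ : a → ℂ := fun i => (v i : ℂ) with hζ
    have hζ0 : ζ ≠ 0 := by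
      intro h0
      apply hv
      ext i
      simpa [hζ] using congrFun h0 i
    have h1 : 0 < V ζ := (hVnonneg _).trans_lt (hstrict ζ hζ0)
    simp only [hV, hPc, re_star_dotProduct_map, hζ, Complex.ofReal_re, Complex.ofReal_im] at h1
    have hz : (fun _ : a => (0 : ℝ)) = 0 := rfl
    rw [hz, zero_dotProduct, add_zero] at h1
    simpa using h1

end Hurwitz

/-! ### Transfer functions on the imaginary axis -/

section Transfer

/-- The state response `x = (s I - A)⁻¹ B u` satisfies `A x + B u = s x`. -/
theorem IsHurwitz.exists_state {a b c : Type*} [Fintype a] [DecidableEq a] [Fintype b]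
    {A : Matrix a a ℝ} (hA : IsHurwitz A) {s : ℂ} (hs : 0 ≤ s.re)
    (B : Matrix a b ℝ) (C : Matrix c a ℝ) (u : b → ℂ) :
    ∃ x : a → ℂ, A.map ((↑) : ℝ → ℂ) *ᵥ x + B.map ((↑) : ℝ → ℂ) *ᵥ u = s • x ∧
      transfer A B C s *ᵥ u = C.map ((↑) : ℝ → ℂ) *ᵥ x := by
  have hu := (isUnit_iff_isUnit_det _).mp (hA.isUnit_sub hs)
  refine ⟨(s • (1 : Matrix a a ℂ) - A.map ((↑) : ℝ → ℂ))⁻¹ *ᵥ (B.map ((↑) : ℝ → ℂ) *ᵥ u),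
    ?_, ?_⟩
  · have h1 : (s • (1 : Matrix a a ℂ) - A.map ((↑) : ℝ → ℂ)) *ᵥ
        ((s • (1 : Matrix a a ℂ) - A.map ((↑) : ℝ → ℂ))⁻¹ *ᵥ (B.map ((↑) : ℝ → ℂ) *ᵥ u))
        = B.map ((↑) : ℝ → ℂ) *ᵥ u := by
      rw [mulVec_mulVec, mul_nonsing_inv _ hu, one_mulVec]
    rw [sub_mulVec, smul_mulVec, one_mulVec] at h1
    nth_rewrite 2 [← h1]
    abel
  · simp only [transfer, mulVec_mulVec, Matrix.mul_assoc]

variable {a b c : Type*} [Fintype a] [DecidableEq a] [Fintype b] [DecidableEq b] [Fintype c]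

-- The resolvent is continuous on the imaginary axis and vanishes at infinity. Boundedness has to be
-- known before `hInfNorm` dominates the individual values, since a real supremum over an unbounded
-- set is 0.
open Filter Topology in
open scoped Matrix.Norms.L2Operator in
theorem IsHurwitz.bddAbove_sigmaMax_transfer {A : Matrix a a ℝ} (hA : IsHurwitz A)
    (B : Matrix a b ℝ) (C : Matrix c a ℝ) :
    BddAbove (Set.range fun ω : ℝ => sigmaMax (transfer A B C (Complex.I * (ω : ℂ)))) := by
  classical
  set Ac := A.map ((↑) : ℝ → ℂ) with hAc
  have hres : ∀ s : ℂ, (s • (1 : Matrix a a ℂ) - Ac)⁻¹ = resolvent Ac s := by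
    intro s
    rw [resolvent, ← nonsing_inv_eq_ringInverse, Algebra.algebraMap_eq_smul_one]
  have hlim : Tendsto (fun ω : ℝ => ‖resolvent Ac (Complex.I * (ω : ℂ))‖)
      (Bornology.cobounded ℝ) (𝓝 0) := by
    have h1 : Tendsto (fun ω : ℝ => Complex.I * (ω : ℂ)) (Bornology.cobounded ℝ)
        (Bornology.cobounded ℂ) := by
      rw [← tendsto_norm_atTop_iff_cobounded]
      have h2 : (fun ω : ℝ => ‖Complex.I * (ω : ℂ)‖) = norm := by
        ext ω
        simp
      rw [h2]
      exact tendsto_norm_cobounded_atTop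
    simpa only [norm_zero] using! ((spectrum.resolvent_tendsto_cobounded Ac (𝕜 := ℂ)).comp h1).norm
  have hcont : Continuous fun ω : ℝ => ‖resolvent Ac (Complex.I * (ω : ℂ))‖ := by
    refine Continuous.norm (continuous_iff_continuousAt.mpr fun ω => ?_)
    have hω : Complex.I * (ω : ℂ) ∈ resolventSet ℂ Ac := by
      rw [spectrum.mem_resolventSet_iff, Algebra.algebraMap_eq_smul_one]
      exact hA.isUnit_sub (by simp)
    have h2 : Continuous fun ω : ℝ => Complex.I * (ω : ℂ) := by fun_prop
    exact ContinuousAt.comp (f := fun ω : ℝ => Complex.I * (ω : ℂ))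
      (spectrum.hasDerivAt_resolvent_const_left hω).continuousAt h2.continuousAt
  have hbdd : ∃ r, ∀ ω : ℝ, ‖resolvent Ac (Complex.I * (ω : ℂ))‖ ≤ r := by
    have hev := hlim.eventually_le_const one_pos
    rw [Metric.cobounded_eq_cocompact] at hev
    obtain ⟨k, hk, hsub⟩ := mem_cocompact.mp hev
    obtain ⟨r, hr⟩ := hk.bddAbove_image hcont.continuousOn
    refine ⟨max r 1, fun ω => ?_⟩
    by_cases hω : ω ∈ k
    · exact le_max_of_le_left (hr ⟨ω, hω, rfl⟩)
    · exact le_max_of_le_right (hsub hω)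
  obtain ⟨r, hr⟩ := hbdd
  refine ⟨‖C.map ((↑) : ℝ → ℂ)‖ * r * ‖B.map ((↑) : ℝ → ℂ)‖, ?_⟩
  rintro _ ⟨ω, rfl⟩
  simp only [transfer, sigmaMax]
  refine (l2_opNorm_mul _ _).trans ?_
  gcongr
  refine (l2_opNorm_mul _ _).trans ?_
  gcongr
  rw [← hAc, hres]
  exact hr ω

theorem hInfNorm_nonneg (T : ℂ → Matrix c b ℂ) : 0 ≤ hInfNorm T :=
  Real.iSup_nonneg fun _ => sigmaMax_nonneg _

theorem IsHurwitz.sigmaMax_transfer_le {A : Matrix a a ℝ} (hA : IsHurwitz A)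
    (B : Matrix a b ℝ) (C : Matrix c a ℝ) (ω : ℝ) :
    sigmaMax (transfer A B C (Complex.I * (ω : ℂ))) ≤ hInfNorm (transfer A B C) :=
  le_ciSup (hA.bddAbove_sigmaMax_transfer B C) ω

theorem IsHurwitz.eq_inv_mulVec {A : Matrix a a ℝ} (hA : IsHurwitz A) {s : ℂ} (hs : 0 ≤ s.re)
    {x v : a → ℂ} (h : A.map ((↑) : ℝ → ℂ) *ᵥ x + v = s • x) :
    x = (s • (1 : Matrix a a ℂ) - A.map ((↑) : ℝ → ℂ))⁻¹ *ᵥ v := by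
  have hu := (isUnit_iff_isUnit_det _).mp (hA.isUnit_sub hs)
  have hv : v = (s • (1 : Matrix a a ℂ) - A.map ((↑) : ℝ → ℂ)) *ᵥ x := by
    rw [sub_mulVec, smul_mulVec, one_mulVec, ← h, add_sub_cancel_left]
  rw [hv, mulVec_mulVec, nonsing_inv_mul _ hu, one_mulVec]

end Transfer

/-! ### From a frequency bound to a storage function -/

section Dissipativity

variable {a b c : Type*} [Fintype a] [DecidableEq a] [Fintype b] [DecidableEq b] [Fintype c]
  [DecidableEq c]

theorem quadratic_pos_of_posDef {a : Type*} [Fintype a] {X : Matrix a a ℝ} (hX : X.PosDef) (v : a → ℝ) (hv : v ≠ 0) :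
    0 < v ⬝ᵥ (X *ᵥ v) := by
  simpa using hX.dotProduct_mulVec_pos hv

/-- A weighted Cauchy–Schwarz inequality. -/
theorem re_star_dotProduct_le {X : Matrix b b ℝ} (hX : X.PosDef) (v u : b → ℂ) (t : ℝ) :
    2 * t * (star v ⬝ᵥ u).re ≤ t ^ 2 * (star v ⬝ᵥ (X.map ((↑) : ℝ → ℂ) *ᵥ v)).re
      + (star u ⬝ᵥ (X⁻¹.map ((↑) : ℝ → ℂ) *ᵥ u)).re := by
  set Xc := X.map ((↑) : ℝ → ℂ) with hXc
  set Yc := X⁻¹.map ((↑) : ℝ → ℂ) with hYc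
  have hdet : IsUnit X.det := (isUnit_iff_isUnit_det _).mp hX.isUnit
  have hYX : Yc * Xc = 1 := by
    rw [hYc, hXc, ← map_ofReal_mul, nonsing_inv_mul _ hdet]
    simp
  have hXs : Xcᴴ = Xc := by
    rw [hXc, conjTranspose_map_ofReal, PosDef.transpose_eq hX]
  -- The inequality is the expansion of the X⁻¹-weighted square of u - tXv.
  have h0 : 0 ≤ (star (u - (t : ℂ) • (Xc *ᵥ v)) ⬝ᵥ (Yc *ᵥ (u - (t : ℂ) • (Xc *ᵥ v)))).re := by
    by_cases hz : u - (t : ℂ) • (Xc *ᵥ v) = 0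
    · rw [hz]
      simp
    · exact (re_form_pos (quadratic_pos_of_posDef hX.inv) hz).le
  have h1 : star (Xc *ᵥ v) ⬝ᵥ (Yc *ᵥ u) = star v ⬝ᵥ u := by
    rw [star_mulVec_dotProduct, hXs, mulVec_mulVec, mul_eq_one_comm.mp hYX, one_mulVec]
  have h2 : Yc *ᵥ (Xc *ᵥ v) = v := by rw [mulVec_mulVec, hYX, one_mulVec]
  have h3 : (star u ⬝ᵥ v).re = (star v ⬝ᵥ u).re := by
    rw [← Complex.conj_re, ← Complex.star_def, ← star_dotProduct_star, star_star, dotProduct_comm]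
  have h4 : star (Xc *ᵥ v) ⬝ᵥ v = star v ⬝ᵥ (Xc *ᵥ v) := by
    rw [star_mulVec_dotProduct, hXs]
  simp only [mulVec_sub, mulVec_smul, h2, star_sub, star_smul, sub_dotProduct, dotProduct_sub,
    smul_dotProduct, dotProduct_smul, h1, h4, Complex.sub_re, smul_eq_mul, Complex.star_def,
    Complex.conj_ofReal, Complex.re_ofReal_mul, h3] at h0
  nlinarith

/-- Strict dissipativity of a stable system with respect to the supply rate
`uᵀ X⁻¹ u - φ |z|²`, from the frequency domain inequality `φ T X Tᴴ ⪯ ρ I` with `ρ < 1`. -/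
theorem exists_storage_of_transfer_bound {A : Matrix a a ℝ} (hA : IsHurwitz A) (B : Matrix a b ℝ)
    (C : Matrix c a ℝ) {φ ρ : ℝ} (hφ : 0 < φ) (hρ : ρ < 1) {X : Matrix b b ℝ} (hX : X.PosDef)
    (hT : ∀ (ω : ℝ) (z : c → ℂ),
      φ * (star ((transfer A B C (Complex.I * (ω : ℂ)))ᴴ *ᵥ z) ⬝ᵥ (X.map ((↑) : ℝ → ℂ) *ᵥ
        ((transfer A B C (Complex.I * (ω : ℂ)))ᴴ *ᵥ z))).re ≤ ρ * sqNorm z) :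
    ∃ P : Matrix a a ℝ, P.PosDef ∧ ∀ v : a ⊕ b → ℝ, v ≠ 0 →
      v ⬝ᵥ (fromBlocks (P * A + Aᵀ * P + Cᵀ * (φ • (1 : Matrix c c ℝ)) * C) (P * B) (P * B)ᵀ
        (-X⁻¹) *ᵥ v) < 0 := by
  have hXs : X⁻¹ᵀ = X⁻¹ := PosDef.transpose_eq hX.inv
  set K : Matrix (a ⊕ b) (a ⊕ b) ℝ := fromBlocks (φ • (Cᵀ * C)) 0 0 (-X⁻¹) with hK
  have hKs : Kᵀ = K := by
    simp [hK, fromBlocks_transpose, transpose_mul, hXs]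
  -- With E = [1 0] and F = [A B], F ζ = iω E ζ is the state equation at frequency ω, and E ζ = 0 is
  -- the case of infinite frequency.
  set E : Matrix a (a ⊕ b) ℝ := fromCols 1 0 with hE
  set F : Matrix a (a ⊕ b) ℝ := fromCols A B with hF
  have hEζ : ∀ (x : a → ℂ) (u : b → ℂ), E.map ((↑) : ℝ → ℂ) *ᵥ Sum.elim x u = x := by
    intro x u
    have : E.map ((↑) : ℝ → ℂ) = fromCols 1 0 := by
      ext i (j | j)
      · by_cases h : i = j <;> simp [hE, h, one_apply]
      · simp [hE]
    rw [this, fromCols_mulVec]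
    simp
  have hFζ : ∀ (x : a → ℂ) (u : b → ℂ), F.map ((↑) : ℝ → ℂ) *ᵥ Sum.elim x u
      = A.map ((↑) : ℝ → ℂ) *ᵥ x + B.map ((↑) : ℝ → ℂ) *ᵥ u := by
    intro x u
    have : F.map ((↑) : ℝ → ℂ) = fromCols (A.map ((↑) : ℝ → ℂ)) (B.map ((↑) : ℝ → ℂ)) := by
      ext i (j | j) <;> simp [hF]
    rw [this, fromCols_mulVec]
    simp
  have hKζ : ∀ (x : a → ℂ) (u : b → ℂ),
      (star (Sum.elim x u) ⬝ᵥ (K.map ((↑) : ℝ → ℂ) *ᵥ Sum.elim x u)).re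
        = φ * sqNorm (C.map ((↑) : ℝ → ℂ) *ᵥ x)
          - (star u ⬝ᵥ (X⁻¹.map ((↑) : ℝ → ℂ) *ᵥ u)).re := by
    intro x u
    have h1 : K.map ((↑) : ℝ → ℂ) = fromBlocks ((φ : ℂ) • ((C.map ((↑) : ℝ → ℂ))ᴴ
        * C.map ((↑) : ℝ → ℂ))) 0 0 (-X⁻¹.map ((↑) : ℝ → ℂ)) := by
      rw [conjTranspose_map_ofReal, ← map_ofReal_mul, ← map_ofReal_smul, hK, fromBlocks_map]
      congr 1 <;> ext <;> simp
    have h2 : star (Sum.elim x u) = Sum.elim (star x) (star u) := by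
      ext (i | i) <;> rfl
    rw [h1, h2, fromBlocks_mulVec, sumElim_dotProduct_sumElim]
    simp only [Sum.elim_comp_inl, Sum.elim_comp_inr, zero_mulVec, add_zero, zero_add, smul_mulVec,
      dotProduct_smul, neg_mulVec, dotProduct_neg, smul_eq_mul, Complex.add_re,
      Complex.neg_re, Complex.re_ofReal_mul]
    rw [← mulVec_mulVec, ← star_mulVec_dotProduct, star_dotProduct_self]
    simp
    ring
  obtain ⟨P, hP, hneg⟩ := exists_storage_of_frequency_condition E F K hKs (by
    intro ζ hζ hcase
    obtain ⟨x, u, rfl⟩ : ∃ x u, ζ = Sum.elim x u :=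
      ⟨ζ ∘ Sum.inl, ζ ∘ Sum.inr, (Sum.elim_comp_inl_inr ζ).symm⟩
    rw [hEζ, hFζ] at hcase
    rw [hKζ]
    rcases hcase with ⟨ω, hω⟩ | rfl
    · set s : ℂ := Complex.I * (ω : ℂ) with hs
      have hs0 : 0 ≤ s.re := by simp [hs]
      have hx := hA.eq_inv_mulVec hs0 hω
      have hu : u ≠ 0 := by
        rintro rfl
        apply hζ
        rw [mulVec_zero, mulVec_zero] at hx
        rw [hx]
        ext (i | i) <;> rfl
      set T := transfer A B C s with hTdef
      have hz : C.map ((↑) : ℝ → ℂ) *ᵥ x = T *ᵥ u := by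
        rw [hx, hTdef, transfer]
        simp only [mulVec_mulVec, Matrix.mul_assoc]
      rw [hz]
      set z := T *ᵥ u with hzdef
      -- With v = Tᴴz and t = φ this reads 2φ|z|² ≤ φ² v*Xv + u*X⁻¹u ≤ φρ|z|² + u*X⁻¹u. Since ρ < 1,
      -- strictness follows if z ≠ 0; if z = 0 it comes from u ≠ 0.
      have h1 := re_star_dotProduct_le hX (Tᴴ *ᵥ z) u φ
      have h2 : star (Tᴴ *ᵥ z) ⬝ᵥ u = (sqNorm z : ℂ) := by
        rw [star_mulVec_dotProduct, conjTranspose_conjTranspose, ← hzdef, star_dotProduct_self]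
        rfl
      have h3 := hT ω z
      rw [h2, Complex.ofReal_re] at h1
      have h4 := re_form_pos (quadratic_pos_of_posDef hX.inv) hu
      rcases (sqNorm_nonneg z).eq_or_lt with h5 | h5
      · rw [← h5]
        linarith
      · have h6 := mul_le_mul_of_nonneg_left h3 hφ.le
        have h7 : 0 < φ * sqNorm z := mul_pos hφ h5
        nlinarith
    · have hu : u ≠ 0 := by
        rintro rfl
        apply hζ
        ext (i | i) <;> rfl
      have h4 := re_form_pos (quadratic_pos_of_posDef hX.inv) hu
      simp [sqNorm]
      exact h4)
  have hblock : K + Eᵀ * P * F + Fᵀ * P * E = fromBlocks (P * A + Aᵀ * P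
      + Cᵀ * (φ • (1 : Matrix c c ℝ)) * C) (P * B) (P * B)ᵀ (-X⁻¹) := by
    rw [hK, hE, hF, transpose_fromCols, transpose_fromCols, fromRows_mul, fromRows_mul, fromRows_mul,
      fromRows_mul_fromCols, mul_fromCols, mul_fromCols, fromRows_fromCols_eq_fromBlocks,
      fromBlocks_add, fromBlocks_add]
    simp [transpose_mul, hP]
    abel
  -- Setting the input to zero leaves PA + AᵀP ≺ -φCᵀC ⪯ 0, so Lyapunov's theorem applies.
  refine ⟨P, hA.posDef_of_lyapunov hP fun x hx => ?_, fun v hv => hblock ▸ hneg v hv⟩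
  have h1 := hneg (Sum.elim x 0) (by
    intro h0
    apply hx
    ext i
    exact congrFun h0 (Sum.inl i))
  rw [hblock, fromBlocks_mulVec, ← Sum.elim_comp_inl_inr (Sum.elim x 0),
    sumElim_dotProduct_sumElim] at h1
  simp only [Sum.elim_comp_inl, Sum.elim_comp_inr, mulVec_zero, add_zero, zero_dotProduct,
    add_mulVec, dotProduct_add] at h1
  have h2 : x ⬝ᵥ ((Cᵀ * (φ • (1 : Matrix c c ℝ)) * C) *ᵥ x) = φ * sqNorm (C *ᵥ x) := by
    rw [Matrix.mul_smul, Matrix.mul_one, Matrix.smul_mul, smul_mulVec, dotProduct_smul,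
      ← mulVec_mulVec, dotProduct_mulVec, vecMul_transpose, dotProduct_self_eq_sqNorm, smul_eq_mul]
  rw [h2] at h1
  rw [add_mulVec, dotProduct_add]
  have := mul_nonneg hφ.le (sqNorm_nonneg (C *ᵥ x))
  linarith

end Dissipativity

/-! ### Consequences of the strict Riccati inequality -/

section BoundedReal

theorem star_dotProduct_transpose_mul_self {a d : Type*} [Fintype a] [Fintype d]
    (X : Matrix d a ℝ) (ζ : a → ℂ) :
    star ζ ⬝ᵥ ((Xᵀ * X).map ((↑) : ℝ → ℂ) *ᵥ ζ) = (sqNorm (X.map ((↑) : ℝ → ℂ) *ᵥ ζ) : ℂ) := by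
  rw [map_ofReal_mul, ← conjTranspose_map_ofReal, ← mulVec_mulVec, ← star_mulVec_dotProduct,
    star_dotProduct_self]
  rfl

/-- The form of the Riccati expression at a complex vector. -/
theorem re_riccati_form {a b c : Type*} [Fintype a] [Fintype b] [Fintype c]
    {P : Matrix a a ℝ} (hP : Pᵀ = P) (A : Matrix a a ℝ) (B : Matrix a b ℝ)
    (C : Matrix c a ℝ) (r : ℝ) (ζ : a → ℂ) :
    (star ζ ⬝ᵥ ((P * A + Aᵀ * P + Cᵀ * C + r • (P * B * Bᵀ * P)).map ((↑) : ℝ → ℂ) *ᵥ ζ)).re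
      = 2 * (star (P.map ((↑) : ℝ → ℂ) *ᵥ ζ) ⬝ᵥ (A.map ((↑) : ℝ → ℂ) *ᵥ ζ)).re
        + sqNorm (C.map ((↑) : ℝ → ℂ) *ᵥ ζ)
        + r * sqNorm (Bᵀ.map ((↑) : ℝ → ℂ) *ᵥ (P.map ((↑) : ℝ → ℂ) *ᵥ ζ)) := by
  have h1 : P * B * Bᵀ * P = (Bᵀ * P)ᵀ * (Bᵀ * P) := by
    rw [transpose_mul, transpose_transpose, hP]
    simp only [Matrix.mul_assoc]
  rw [map_ofReal_add, map_ofReal_add, add_mulVec, add_mulVec, dotProduct_add, dotProduct_add,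
    Complex.add_re, Complex.add_re, re_lyapunov_form hP, star_dotProduct_transpose_mul_self, map_ofReal_smul, smul_mulVec,
    dotProduct_smul, smul_eq_mul, Complex.re_ofReal_mul, h1,
    star_dotProduct_transpose_mul_self, Complex.ofReal_re, Complex.ofReal_re, map_ofReal_mul,
    ← mulVec_mulVec]

variable {a b c : Type*} [Fintype a] [DecidableEq a] [Fintype b] [Fintype c]

/-- At an eigenvector ζ with eigenvalue μ the Riccati form equals 2 Re μ · ζ*Pζ plus nonnegative
terms. -/
theorem isHurwitz_of_riccati {A P : Matrix a a ℝ} (B : Matrix a b ℝ) (C : Matrix c a ℝ)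
    {r : ℝ} (hr : 0 ≤ r) (hP : P.PosDef)
    (h : ∀ v : a → ℝ, v ≠ 0 →
      v ⬝ᵥ ((P * A + Aᵀ * P + Cᵀ * C + r • (P * B * Bᵀ * P)) *ᵥ v) < 0) : IsHurwitz A := by
  have hPs : Pᵀ = P := PosDef.transpose_eq hP
  intro μ hμ
  obtain ⟨ζ, hζ, hAζ⟩ := exists_eigenvector_of_mem_spectrum hμ
  have h1 := re_form_neg h hζ
  rw [re_riccati_form hPs, hAζ, dotProduct_smul, smul_eq_mul, Complex.mul_re,
    star_form_im_eq_zero hPs, mul_zero, sub_zero, star_mulVec_dotProduct,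
    conjTranspose_map_ofReal, hPs] at h1
  have h2 := re_form_pos (quadratic_pos_of_posDef hP) hζ
  have h3 := sqNorm_nonneg (C.map ((↑) : ℝ → ℂ) *ᵥ ζ)
  have h4 := mul_nonneg hr (sqNorm_nonneg (Bᵀ.map ((↑) : ℝ → ℂ) *ᵥ (P.map ((↑) : ℝ → ℂ) *ᵥ ζ)))
  by_contra hcon
  push Not at hcon
  have := mul_nonneg hcon h2.le
  linarith

-- Negativity is an open condition, so it survives adding a small εI. The resulting margin is
-- uniform in the frequency, which keeps the supremum in `hInfNorm` strictly below δ.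
open Filter Topology in
theorem exists_quadratic_le_neg_smul {K : Matrix a a ℝ}
    (hK : ∀ v : a → ℝ, v ≠ 0 → v ⬝ᵥ (K *ᵥ v) < 0) :
    ∃ ε : ℝ, 0 < ε ∧ ∀ ζ : a → ℂ, (star ζ ⬝ᵥ (K.map ((↑) : ℝ → ℂ) *ᵥ ζ)).re ≤ -ε * sqNorm ζ := by
  have hc : Continuous fun t : ℝ => K + t • (1 : Matrix a a ℝ) := by fun_prop
  have hmem : ∀ᶠ t in 𝓝 (0 : ℝ), K + t • (1 : Matrix a a ℝ) ∈
      {N : Matrix a a ℝ | ∀ v : a → ℝ, v ≠ 0 → v ⬝ᵥ (N *ᵥ v) < 0} :=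
    hc.continuousAt.eventually_mem (isOpen_setOf_quadratic_neg.mem_nhds (by simpa using hK))
  obtain ⟨ε, hε, hε0⟩ := ((hmem.filter_mono nhdsWithin_le_nhds).and
    (self_mem_nhdsWithin (s := Set.Ioi (0 : ℝ)))).exists
  refine ⟨ε, hε0, fun ζ => ?_⟩
  by_cases hζ : ζ = 0
  · simp [hζ, sqNorm]
  have h1 := re_form_neg hε hζ
  have h2 : (ε • (1 : Matrix a a ℝ)).map ((↑) : ℝ → ℂ) = (ε : ℂ) • 1 := by
    rw [map_ofReal_smul]
    congr 1
    ext i j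
    by_cases hij : i = j <;> simp [hij, one_apply]
  rw [map_ofReal_add, add_mulVec, dotProduct_add, Complex.add_re, h2, smul_mulVec, one_mulVec,
    dotProduct_smul, smul_eq_mul, Complex.re_ofReal_mul, star_dotProduct_self] at h1
  simp only [Complex.coe_algebraMap, Complex.ofReal_re] at h1
  linarith

/-- **Bounded real lemma**, sufficiency of the strict Riccati inequality. -/
theorem hInfNorm_lt_of_riccati [DecidableEq b] {A P : Matrix a a ℝ} (B : Matrix a b ℝ) (C : Matrix c a ℝ)
    {δ : ℝ} (hδ : 0 < δ) (hP : P.PosDef)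
    (h : ∀ v : a → ℝ, v ≠ 0 →
      v ⬝ᵥ ((P * A + Aᵀ * P + Cᵀ * C + (1 / δ ^ 2) • (P * B * Bᵀ * P)) *ᵥ v) < 0) :
    hInfNorm (transfer A B C) < δ := by
  have hPs : Pᵀ = P := PosDef.transpose_eq hP
  have hA : IsHurwitz A := isHurwitz_of_riccati B C (by positivity) hP h
  obtain ⟨ε, hε, hεK⟩ := exists_quadratic_le_neg_smul h
  set κ := sigmaMax (C.map ((↑) : ℝ → ℂ)) with hκ
  -- Since |Cx|² ≤ (κ² + 1)|x|², the margin ε|x|² is worth an extra ε/(κ² + 1) times |Cx|², giving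
  -- q|Cx|² ≤ δ²|u|²; the added 1 covers κ = 0.
  set q := 1 + ε / (κ ^ 2 + 1) with hq
  have hq1 : 1 < q := by
    have : 0 < ε / (κ ^ 2 + 1) := by positivity
    linarith
  have hbound : ∀ ω : ℝ, sigmaMax (transfer A B C (Complex.I * (ω : ℂ))) ≤ δ / √q := by
    intro ω
    refine sigmaMax_le (by positivity) fun u => ?_
    obtain ⟨x, hx, hTu⟩ := hA.exists_state (s := Complex.I * (ω : ℂ)) (by simp) B C u
    have h1 := hεK x
    rw [re_riccati_form hPs, eq_sub_of_add_eq hx] at h1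
    set p := Bᵀ.map ((↑) : ℝ → ℂ) *ᵥ (P.map ((↑) : ℝ → ℂ) *ᵥ x) with hp
    have h2 : (star (P.map ((↑) : ℝ → ℂ) *ᵥ x) ⬝ᵥ
        ((Complex.I * (ω : ℂ)) • x - B.map ((↑) : ℝ → ℂ) *ᵥ u)).re = -(star p ⬝ᵥ u).re := by
      rw [dotProduct_sub, Complex.sub_re, dotProduct_smul, smul_eq_mul, Complex.mul_re,
        star_form_im_eq_zero hPs, hp,
        star_mulVec_dotProduct (Bᵀ.map ((↑) : ℝ → ℂ)), conjTranspose_map_ofReal,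
        transpose_transpose]
      simp
    -- Completing the square in u, with p = BᵀPx, absorbs the cross term 2 Re p*u.
    have h3 : 0 ≤ sqNorm (p - ((δ ^ 2 : ℝ) : ℂ) • u) := sqNorm_nonneg _
    have h4 : sqNorm (p - ((δ ^ 2 : ℝ) : ℂ) • u)
        = sqNorm p - 2 * δ ^ 2 * (star p ⬝ᵥ u).re + δ ^ 4 * sqNorm u := by
      have e0 : ∀ v : b → ℂ, sqNorm v = (star v ⬝ᵥ v).re := by
        intro v
        rw [star_dotProduct_self]
        rfl
      have e1 : (star u ⬝ᵥ p).re = (star p ⬝ᵥ u).re := by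
        rw [← Complex.conj_re, ← Complex.star_def, ← star_dotProduct_star, star_star,
          dotProduct_comm]
      rw [e0, e0 p, e0 u]
      simp only [star_sub, star_smul, sub_dotProduct, dotProduct_sub, smul_dotProduct,
        dotProduct_smul, Complex.sub_re, smul_eq_mul, Complex.star_def, Complex.conj_ofReal,
        Complex.re_ofReal_mul, e1]
      ring
    rw [h2] at h1
    rw [h4] at h3
    have h5 : 2 * (star p ⬝ᵥ u).re ≤ 1 / δ ^ 2 * sqNorm p + δ ^ 2 * sqNorm u := by
      have h6 := mul_nonneg (show 0 ≤ 1 / δ ^ 2 by positivity) h3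
      have h7 : 1 / δ ^ 2 * (sqNorm p - 2 * δ ^ 2 * (star p ⬝ᵥ u).re + δ ^ 4 * sqNorm u)
          = 1 / δ ^ 2 * sqNorm p - 2 * (star p ⬝ᵥ u).re + δ ^ 2 * sqNorm u := by
        field_simp
      linarith
    have h8 : sqNorm (C.map ((↑) : ℝ → ℂ) *ᵥ x) / (κ ^ 2 + 1) ≤ sqNorm x := by
      rw [div_le_iff₀ (by positivity)]
      have := sqNorm_mulVec_le (C.map ((↑) : ℝ → ℂ)) x
      nlinarith [sqNorm_nonneg x]
    have h9 : sqNorm (C.map ((↑) : ℝ → ℂ) *ᵥ x) * q ≤ δ ^ 2 * sqNorm u := by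
      have := mul_le_mul_of_nonneg_left h8 hε.le
      have e : sqNorm (C.map ((↑) : ℝ → ℂ) *ᵥ x) * q = sqNorm (C.map ((↑) : ℝ → ℂ) *ᵥ x)
          + ε * (sqNorm (C.map ((↑) : ℝ → ℂ) *ᵥ x) / (κ ^ 2 + 1)) := by
        rw [hq]
        ring
      rw [e]
      linarith
    rw [hTu, div_pow, Real.sq_sqrt (by linarith), div_mul_eq_mul_div, le_div_iff₀ (by linarith)]
    exact h9
  refine (ciSup_le hbound).trans_lt (div_lt_self hδ ?_)
  rw [Real.lt_sqrt zero_le_one]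
  simpa using hq1

end BoundedReal

/-! ### Supply rates built from channel gains -/

section SupplyRate

/-- The weighted sum `∑ k, α k • L k (L k)ᵀ`. -/
noncomputable def weightedGram {b κ : Type*} {m : κ → Type*} [Fintype κ] [∀ k, Fintype (m k)]
    (α : κ → ℝ) (L : ∀ k, Matrix b (m k) ℝ) : Matrix b b ℝ :=
  ∑ k, α k • (L k * (L k)ᵀ)

variable {b κ : Type*} [Fintype b] [Fintype κ] {m : κ → Type*} [∀ k, Fintype (m k)]

theorem weightedGram_posSemidef {α : κ → ℝ} (hα : ∀ k, 0 < α k) (L : ∀ k, Matrix b (m k) ℝ) :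
    (weightedGram α L).PosSemidef := by
  refine posSemidef_sum _ fun k _ => PosSemidef.smul ?_ (hα k).le
  rw [← conjTranspose_eq_transpose_of_trivial]
  exact posSemidef_self_mul_conjTranspose _

theorem dotProduct_weightedGram (α : κ → ℝ) (L : ∀ k, Matrix b (m k) ℝ) (v : b → ℝ) :
    v ⬝ᵥ (weightedGram α L *ᵥ v) = ∑ k, α k * sqNorm ((L k)ᵀ *ᵥ v) := by
  rw [weightedGram, sum_mulVec, dotProduct_sum]
  refine Finset.sum_congr rfl fun k _ => ?_
  rw [smul_mulVec, dotProduct_smul, ← mulVec_mulVec, dotProduct_mulVec, ← mulVec_transpose,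
    dotProduct_self_eq_sqNorm, smul_eq_mul]

theorem re_star_dotProduct_weightedGram (α : κ → ℝ) (L : ∀ k, Matrix b (m k) ℝ) (v : b → ℂ) :
    (star v ⬝ᵥ ((weightedGram α L).map ((↑) : ℝ → ℂ) *ᵥ v)).re
      = ∑ k, α k * sqNorm (((L k).map ((↑) : ℝ → ℂ))ᴴ *ᵥ v) := by
  have h : (weightedGram α L).map ((↑) : ℝ → ℂ)
      = ∑ k, (α k : ℂ) • ((L k).map ((↑) : ℝ → ℂ) * ((L k).map ((↑) : ℝ → ℂ))ᴴ) := by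
    ext i j
    simp [weightedGram, Matrix.sum_apply, Matrix.mul_apply]
  rw [h, sum_mulVec, dotProduct_sum, Complex.re_sum]
  refine Finset.sum_congr rfl fun k _ => ?_
  have h2 := star_mulVec_dotProduct ((L k).map ((↑) : ℝ → ℂ))ᴴ v
    (((L k).map ((↑) : ℝ → ℂ))ᴴ *ᵥ v)
  rw [conjTranspose_conjTranspose, star_dotProduct_self] at h2
  rw [smul_mulVec, dotProduct_smul, ← mulVec_mulVec, ← h2, smul_eq_mul, Complex.re_ofReal_mul]
  rfl

/-- Multiplying T by R on the right only replaces the input matrix B by BR, and passing to the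
adjoint does not change the operator norm. -/
theorem IsHurwitz.sqNorm_conjTranspose_transfer_le {a b c d : Type*} [Fintype a] [DecidableEq a]
    [Fintype b] [Fintype c] [DecidableEq c] [Fintype d] [DecidableEq d]
    {A : Matrix a a ℝ} (hA : IsHurwitz A) (B : Matrix a b ℝ) (C : Matrix c a ℝ)
    (R : Matrix b d ℝ) (ω : ℝ) (z : c → ℂ) :
    sqNorm ((R.map ((↑) : ℝ → ℂ))ᴴ *ᵥ ((transfer A B C (Complex.I * (ω : ℂ)))ᴴ *ᵥ z))
      ≤ hInfNorm (transfer A (B * R) C) ^ 2 * sqNorm z := by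
  have e : (R.map ((↑) : ℝ → ℂ))ᴴ * (transfer A B C (Complex.I * (ω : ℂ)))ᴴ
      = (transfer A (B * R) C (Complex.I * (ω : ℂ)))ᴴ := by
    rw [← conjTranspose_mul, transfer, transfer, map_ofReal_mul]
    simp only [Matrix.mul_assoc]
  rw [mulVec_mulVec, e]
  refine (sqNorm_mulVec_le _ z).trans ?_
  rw [sigmaMax_conjTranspose]
  have := hA.sigmaMax_transfer_le (B * R) C ω
  have := sigmaMax_nonneg (transfer A (B * R) C (Complex.I * (ω : ℂ)))
  gcongr
  exact sqNorm_nonneg z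

theorem two_mul_dotProduct_le {d : Type*} [Fintype d] (x y : d → ℝ) {t : ℝ} (ht : 0 < t) :
    2 * (x ⬝ᵥ y) ≤ t * sqNorm x + sqNorm y / t := by
  have h := sqNorm_nonneg (t • x - y)
  rw [← dotProduct_self_eq_sqNorm] at h
  simp only [sub_dotProduct, dotProduct_sub, smul_dotProduct, dotProduct_smul, smul_eq_mul,
    dotProduct_comm y x, dotProduct_self_eq_sqNorm, mul_sub] at h
  have e : t * sqNorm x + sqNorm y / t - 2 * (x ⬝ᵥ y)
      = (t * (t * sqNorm x) - t * (x ⬝ᵥ y) - (t * (x ⬝ᵥ y) - sqNorm y)) / t := by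
    field_simp
    ring
  have := div_nonneg h ht.le
  linarith

/-- A stable system whose gains from the input channels `L k` and `N l` satisfy a weighted
bound is strictly dissipative, with a supply rate that is controlled by the channel weights. -/
theorem exists_supply_of_gain_bound {a b c κ κ' : Type*} [Fintype a] [DecidableEq a] [Fintype b]
    [DecidableEq b] [Fintype c] [DecidableEq c] [Fintype κ] [Fintype κ'] {m : κ → Type*}
    [∀ k, Fintype (m k)] [∀ k, DecidableEq (m k)] {m' : κ' → Type*} [∀ k, Fintype (m' k)]
    [∀ k, DecidableEq (m' k)] {A : Matrix a a ℝ} (hA : IsHurwitz A) (B : Matrix a b ℝ)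
    (C : Matrix c a ℝ) {φ ε : ℝ} (hφ : 0 < φ) (hε : 0 < ε)
    (L : ∀ k, Matrix b (m k) ℝ) (N : ∀ l, Matrix b (m' l) ℝ)
    {α : κ → ℝ} {β : κ' → ℝ} (hα : ∀ k, 0 < α k) (hβ : ∀ l, 0 < β l)
    (hgain : φ * (∑ k, α k * hInfNorm (transfer A (B * L k) C) ^ 2
      + ∑ l, β l * hInfNorm (transfer A (B * N l) C) ^ 2
      + ε * hInfNorm (transfer A B C) ^ 2) < 1) :
    ∃ (Y : Matrix b b ℝ) (P : Matrix a a ℝ), Y.PosDef ∧ P.PosDef ∧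
      (∀ v : a ⊕ b → ℝ, v ≠ 0 →
        v ⬝ᵥ (fromBlocks (P * A + Aᵀ * P + Cᵀ * (φ • (1 : Matrix c c ℝ)) * C) (P * B) (P * B)ᵀ
          (-Y) *ᵥ v) < 0) ∧
      ∀ (z : ∀ k, m k → ℝ) (u : ∀ l, m' l → ℝ),
        (∑ k, L k *ᵥ z k + ∑ l, N l *ᵥ u l) ⬝ᵥ (Y *ᵥ (∑ k, L k *ᵥ z k + ∑ l, N l *ᵥ u l))
          ≤ ∑ k, sqNorm (z k) / α k + ∑ l, sqNorm (u l) / β l := by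
  -- The supply matrix is X⁻¹. The term εI makes X invertible even when the channels do not span the
  -- input space.
  set X : Matrix b b ℝ := weightedGram α L + weightedGram β N + ε • 1 with hXdef
  have hX : X.PosDef :=
    PosDef.posSemidef_add
      (PosSemidef.add (weightedGram_posSemidef hα L) (weightedGram_posSemidef hβ N))
      (PosDef.one.smul hε)
  have hdet : IsUnit X.det := (isUnit_iff_isUnit_det _).mp hX.isUnit
  have h1c : (1 : Matrix b b ℝ).map ((↑) : ℝ → ℂ) = 1 := by
    ext i j
    by_cases hij : i = j <;> simp [hij, one_apply]
  have hgain1 : ∀ (ω : ℝ) (z : c → ℂ),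
      sqNorm ((transfer A B C (Complex.I * (ω : ℂ)))ᴴ *ᵥ z)
        ≤ hInfNorm (transfer A B C) ^ 2 * sqNorm z := by
    intro ω z
    have := hA.sqNorm_conjTranspose_transfer_le B C (1 : Matrix b b ℝ) ω z
    rwa [Matrix.mul_one, conjTranspose_map_ofReal, transpose_one, h1c, one_mulVec] at this
  obtain ⟨P, hP, hneg⟩ := exists_storage_of_transfer_bound hA B C hφ hgain hX (by
    intro ω z
    set v := (transfer A B C (Complex.I * (ω : ℂ)))ᴴ *ᵥ z with hv
    rw [hXdef, map_ofReal_add, map_ofReal_add, add_mulVec, add_mulVec, dotProduct_add,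
      dotProduct_add, Complex.add_re, Complex.add_re, re_star_dotProduct_weightedGram,
      re_star_dotProduct_weightedGram, map_ofReal_smul, h1c, smul_mulVec, one_mulVec,
      dotProduct_smul, smul_eq_mul, Complex.re_ofReal_mul, star_dotProduct_self, mul_assoc φ]
    refine mul_le_mul_of_nonneg_left ?_ hφ.le
    rw [add_mul, add_mul, Finset.sum_mul, Finset.sum_mul]
    refine add_le_add (add_le_add (Finset.sum_le_sum fun k _ => ?_)
      (Finset.sum_le_sum fun l _ => ?_)) ?_
    · rw [mul_assoc]
      exact mul_le_mul_of_nonneg_left (hA.sqNorm_conjTranspose_transfer_le B C (L k) ω z) (hα k).le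
    · rw [mul_assoc]
      exact mul_le_mul_of_nonneg_left (hA.sqNorm_conjTranspose_transfer_le B C (N l) ω z) (hβ l).le
    · rw [mul_assoc]
      exact mul_le_mul_of_nonneg_left (hgain1 ω z) hε.le)
  refine ⟨X⁻¹, P, hX.inv, hP, hneg, fun z u => ?_⟩
  set w := ∑ k, L k *ᵥ z k + ∑ l, N l *ᵥ u l with hw
  -- The number w·p = wᵀX⁻¹w is computed twice: as pᵀXp (`e1`), and as a pairing of the Lᵀp and Nᵀp
  -- with z and u (`e2`). Young's inequality on the second bounds 2 w·p by the first plus the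
  -- desired right side, up to the nonnegative ε|p|².
  set p := X⁻¹ *ᵥ w with hp
  have hXp : X *ᵥ p = w := by rw [hp, mulVec_mulVec, mul_nonsing_inv _ hdet, one_mulVec]
  have e1 : w ⬝ᵥ p = ∑ k, α k * sqNorm ((L k)ᵀ *ᵥ p) + ∑ l, β l * sqNorm ((N l)ᵀ *ᵥ p)
      + ε * sqNorm p := by
    rw [dotProduct_comm]
    conv_lhs => rw [← hXp]
    rw [hXdef, add_mulVec, add_mulVec, dotProduct_add, dotProduct_add, dotProduct_weightedGram,
      dotProduct_weightedGram, smul_mulVec, one_mulVec, dotProduct_smul,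
      dotProduct_self_eq_sqNorm, smul_eq_mul]
  have e2 : w ⬝ᵥ p = ∑ k, ((L k)ᵀ *ᵥ p) ⬝ᵥ z k + ∑ l, ((N l)ᵀ *ᵥ p) ⬝ᵥ u l := by
    rw [hw, add_dotProduct, sum_dotProduct, sum_dotProduct]
    congr 1 <;> refine Finset.sum_congr rfl fun k _ => ?_
    all_goals rw [dotProduct_comm, dotProduct_mulVec, ← mulVec_transpose]
  have e3 : 2 * (w ⬝ᵥ p) ≤ ∑ k, (α k * sqNorm ((L k)ᵀ *ᵥ p) + sqNorm (z k) / α k)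
      + ∑ l, (β l * sqNorm ((N l)ᵀ *ᵥ p) + sqNorm (u l) / β l) := by
    rw [e2, mul_add, Finset.mul_sum, Finset.mul_sum]
    exact add_le_add (Finset.sum_le_sum fun k _ => two_mul_dotProduct_le _ _ (hα k))
      (Finset.sum_le_sum fun l _ => two_mul_dotProduct_le _ _ (hβ l))
  rw [Finset.sum_add_distrib, Finset.sum_add_distrib] at e3
  have := mul_nonneg hε.le (sqNorm_nonneg p)
  linarith

end SupplyRate

/-! ### Partitioned vectors and output bounds -/

section Sigma

variable {ι : Type*} [Fintype ι] {a : ι → Type*} [∀ i, Fintype (a i)]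

theorem dotProduct_sigma (x y : (Σ i, a i) → ℝ) :
    x ⬝ᵥ y = ∑ i, (fun t => x ⟨i, t⟩) ⬝ᵥ (fun t => y ⟨i, t⟩) :=
  Fintype.sum_sigma _

theorem sqNorm_sigma (x : (Σ i, a i) → ℝ) : sqNorm x = ∑ i, sqNorm fun t => x ⟨i, t⟩ :=
  Fintype.sum_sigma _

theorem mulVec_sigma {κ : Type*} {c : κ → Type*} (X : Matrix (Σ k, c k) (Σ i, a i) ℝ)
    (x : (Σ i, a i) → ℝ) (i : κ) : (fun t => (X *ᵥ x) ⟨i, t⟩) = ∑ j, block X i j *ᵥ fun t => x ⟨j, t⟩ := by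
  ext t
  rw [Finset.sum_apply]
  exact Fintype.sum_sigma _

theorem blockDiagonal'_mulVec [DecidableEq ι] {c : ι → Type*} (D : ∀ i, Matrix (c i) (a i) ℝ)
    (x : (Σ i, a i) → ℝ) (i : ι) :
    (fun t => (blockDiagonal' D *ᵥ x) ⟨i, t⟩) = D i *ᵥ fun t => x ⟨i, t⟩ := by
  rw [mulVec_sigma, Finset.sum_eq_single i]
  · congr 1
    ext s t
    exact blockDiagonal'_apply_eq D i s t
  · intro j _ hj
    have : block (blockDiagonal' D) i j = 0 := by
      ext s t
      exact blockDiagonal'_apply_ne D s t hj.symm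
    rw [this, zero_mulVec]
  · intro h
    exact absurd (Finset.mem_univ i) h

end Sigma

section Forms

theorem sqNorm_sum_le {ι a : Type*} [Fintype ι] [Fintype a] (v : ι → a → ℝ) :
    sqNorm (∑ j, v j) ≤ (∑ j, √(sqNorm (v j))) ^ 2 := by
  have h : ∀ j, √(sqNorm (v j)) = ‖WithLp.toLp 2 (v j)‖ := fun j => by
    rw [sqNorm_eq_norm_sq, Real.sqrt_sq (norm_nonneg _)]
  rw [sqNorm_eq_norm_sq, WithLp.toLp_sum]
  simp only [h]
  exact pow_le_pow_left₀ (norm_nonneg _) (norm_sum_le _ _) 2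

/-- Bound on the output of a partitioned matrix whose blocks have gains `H` with `H d ≤ g`. -/
theorem sqNorm_mulVec_le_of_gain {ι κ : Type*} [Fintype ι] [Fintype κ] {a : ι → Type*}
    {b : κ → Type*} [∀ i, Fintype (a i)] [∀ j, Fintype (b j)] [∀ i, DecidableEq (a i)]
    (N : Matrix (Σ k, b k) (Σ j, a j) ℝ) {d : ι → ℝ} {g : κ → ℝ} (hd : ∀ j, 0 < d j)
    (hg : ∀ k, ∑ j, sigmaMax (block N k j) * d j ≤ g k) (z : (Σ j, a j) → ℝ) :
    sqNorm (N *ᵥ z)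
      ≤ ∑ j, (∑ k, sigmaMax (block N k j) * g k) * (sqNorm (fun t => z ⟨j, t⟩) / d j) := by
  have hk : ∀ k, sqNorm (fun t => (N *ᵥ z) ⟨k, t⟩)
      ≤ ∑ j, sigmaMax (block N k j) * g k * (sqNorm (fun t => z ⟨j, t⟩) / d j) := by
    intro k
    rw [mulVec_sigma]
    have h1 : ∑ j, √(sqNorm (block N k j *ᵥ fun t => z ⟨j, t⟩))
        ≤ ∑ j, sigmaMax (block N k j) * √(sqNorm fun t => z ⟨j, t⟩) := by
      refine Finset.sum_le_sum fun j _ => ?_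
      refine (Real.sqrt_le_sqrt (sqNorm_mulVec_le _ _)).trans_eq ?_
      rw [Real.sqrt_mul (sq_nonneg _), Real.sqrt_sq (sigmaMax_nonneg _)]
    have h0 : ∀ j, 0 ≤ sigmaMax (block N k j) * (sqNorm (fun t => z ⟨j, t⟩) / d j) := fun j =>
      mul_nonneg (sigmaMax_nonneg _) (div_nonneg (sqNorm_nonneg _) (hd j).le)
    calc sqNorm (∑ j, block N k j *ᵥ fun t => z ⟨j, t⟩)
        ≤ (∑ j, √(sqNorm (block N k j *ᵥ fun t => z ⟨j, t⟩))) ^ 2 := sqNorm_sum_le _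
      _ ≤ (∑ j, sigmaMax (block N k j) * √(sqNorm fun t => z ⟨j, t⟩)) ^ 2 :=
          pow_le_pow_left₀ (Finset.sum_nonneg fun j _ => Real.sqrt_nonneg _) h1 2
      -- Cauchy–Schwarz with the splitting H_kj |z_j| = √(H_kj d_j) · √(H_kj |z_j|²/d_j).
      _ ≤ (∑ j, sigmaMax (block N k j) * d j)
            * ∑ j, sigmaMax (block N k j) * (sqNorm (fun t => z ⟨j, t⟩) / d j) := by
          refine Finset.sum_sq_le_sum_mul_sum_of_sq_le_mul _
            (fun j _ => mul_nonneg (sigmaMax_nonneg _) (hd j).le) (fun j _ => h0 j) fun j _ => ?_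
          rw [mul_pow, Real.sq_sqrt (sqNorm_nonneg _)]
          have := (hd j).ne'
          refine le_of_eq ?_
          field_simp
      _ ≤ g k * ∑ j, sigmaMax (block N k j) * (sqNorm (fun t => z ⟨j, t⟩) / d j) :=
          mul_le_mul_of_nonneg_right (hg k) (Finset.sum_nonneg fun j _ => h0 j)
      _ = _ := by
          rw [Finset.mul_sum]
          exact Finset.sum_congr rfl fun j _ => by ring
  rw [sqNorm_sigma]
  refine (Finset.sum_le_sum fun k _ => hk k).trans_eq ?_
  rw [Finset.sum_comm]
  exact Finset.sum_congr rfl fun j _ => (Finset.sum_mul _ _ _).symm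

/-- The quadratic form of the local dissipation inequality. -/
theorem dissipation_form {a b c : Type*} [Fintype a] [Fintype b] [Fintype c] [DecidableEq c]
    {P : Matrix a a ℝ} (hP : Pᵀ = P) (A : Matrix a a ℝ) (B : Matrix a b ℝ) (C : Matrix c a ℝ)
    (Y : Matrix b b ℝ) (φ : ℝ) (x : a → ℝ) (w : b → ℝ) :
    Sum.elim x w ⬝ᵥ (fromBlocks (P * A + Aᵀ * P + Cᵀ * (φ • (1 : Matrix c c ℝ)) * C) (P * B)
        (P * B)ᵀ (-Y) *ᵥ Sum.elim x w)
      = 2 * ((P *ᵥ x) ⬝ᵥ (A *ᵥ x + B *ᵥ w)) + φ * sqNorm (C *ᵥ x) - w ⬝ᵥ (Y *ᵥ w) := by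
  have hPx : ∀ v, x ⬝ᵥ (P *ᵥ v) = (P *ᵥ x) ⬝ᵥ v := fun v => by
    rw [dotProduct_mulVec, ← mulVec_transpose, hP]
  have h1 : x ⬝ᵥ ((Cᵀ * (φ • (1 : Matrix c c ℝ)) * C) *ᵥ x) = φ * sqNorm (C *ᵥ x) := by
    rw [Matrix.mul_smul, Matrix.mul_one, Matrix.smul_mul, smul_mulVec, dotProduct_smul,
      ← mulVec_mulVec, dotProduct_mulVec, vecMul_transpose, dotProduct_self_eq_sqNorm, smul_eq_mul]
  have h2 : x ⬝ᵥ ((Aᵀ * P) *ᵥ x) = (P *ᵥ x) ⬝ᵥ (A *ᵥ x) := by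
    rw [← mulVec_mulVec, dotProduct_mulVec, vecMul_transpose, dotProduct_comm]
  have h3 : w ⬝ᵥ ((P * B)ᵀ *ᵥ x) = (P *ᵥ x) ⬝ᵥ (B *ᵥ w) := by
    rw [dotProduct_mulVec, vecMul_transpose, ← mulVec_mulVec, dotProduct_comm, hPx]
  rw [fromBlocks_mulVec, sumElim_dotProduct_sumElim]
  simp only [Sum.elim_comp_inl, Sum.elim_comp_inr, add_mulVec, dotProduct_add, h1, h2, h3,
    neg_mulVec, dotProduct_neg]
  rw [← mulVec_mulVec, ← mulVec_mulVec, hPx, hPx]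
  ring

end Forms

/-! ### The quadratic form of the coupling condition -/

section Coupling

theorem supplyQ_transpose {ι : Type*} [DecidableEq ι] {w z : ι → Type*} {u y : Type*}
    (Y : ∀ i, Matrix (z i ⊕ w i) (z i ⊕ w i) ℝ)
    (W : Matrix (y ⊕ u) (y ⊕ u) ℝ) (hY : ∀ i, (Y i)ᵀ = Y i) (hW : Wᵀ = W) :
    (supplyQ Y W)ᵀ = supplyQ Y W := by
  rw [supplyQ, fromBlocks_transpose, blockDiagonal'_transpose, hW]
  simp [hY]

theorem couplingMap_mulVec {ι : Type*} [Fintype ι] [DecidableEq ι] {w z : ι → Type*} {u y : Type*}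
    [∀ i, Fintype (z i)] [∀ i, DecidableEq (z i)] [Fintype u] [DecidableEq u]
    (M : Matrix (Σ i, w i) (Σ i, z i) ℝ) (N : Matrix y (Σ i, z i) ℝ)
    (K : Matrix (Σ i, w i) u ℝ) (x : (Σ i, z i) → ℝ) (v : u → ℝ) :
    couplingMap M N K *ᵥ Sum.elim x v
      = Sum.elim (Sum.elim (M *ᵥ x + K *ᵥ v) (N *ᵥ x)) (Sum.elim x v) := by
  rw [couplingMap, fromRows_mulVec, fromBlocks_mulVec, one_mulVec]
  simp

variable {ι : Type*} {w z : ι → Type*} {u y : Type*} [Fintype ι] [DecidableEq ι]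
  [∀ i, Fintype (w i)] [∀ i, DecidableEq (w i)] [∀ i, Fintype (z i)] [∀ i, DecidableEq (z i)]
  [Fintype u] [DecidableEq u] [Fintype y] [DecidableEq y]

theorem permT_mulVec (v : ((Σ i, w i) ⊕ y) ⊕ ((Σ i, z i) ⊕ u) → ℝ) :
    permT w z u y *ᵥ v = v ∘ reorder := by
  ext s
  simp [permT, mulVec, dotProduct]

theorem supplyMatrix_form {o i : Type*} [Fintype o] [Fintype i] [DecidableEq o] (φ : ℝ)
    (R : Matrix i i ℝ) (p : o → ℝ) (q : i → ℝ) :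
    Sum.elim p q ⬝ᵥ (supplyMatrix (φ • 1) 0 R *ᵥ Sum.elim p q)
      = φ * sqNorm p - q ⬝ᵥ (R *ᵥ q) := by
  rw [supplyMatrix, fromBlocks_mulVec, sumElim_dotProduct_sumElim]
  simp [smul_mulVec, neg_mulVec, dotProduct_self_eq_sqNorm, sub_eq_add_neg]

/-- The quadratic form of the global coupling condition for diagonal supply rates. -/
theorem coupling_form (M : Matrix (Σ i, w i) (Σ i, z i) ℝ) (N : Matrix y (Σ i, z i) ℝ)
    (K : Matrix (Σ i, w i) u ℝ) (φ : ι → ℝ) (R : ∀ i, Matrix (w i) (w i) ℝ) (r : ℝ)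
    (x : (Σ i, z i) → ℝ) (v : u → ℝ) :
    Sum.elim x v ⬝ᵥ (((couplingMap M N K)ᵀ * ((permT w z u y)ᵀ
        * supplyQ (fun i => supplyMatrix (φ i • (1 : Matrix (z i) (z i) ℝ)) 0 (R i))
          (supplyMatrix (1 : Matrix y y ℝ) 0 (r • (1 : Matrix u u ℝ)))
        * permT w z u y) * couplingMap M N K) *ᵥ Sum.elim x v)
      = ∑ i, ((fun t => (M *ᵥ x + K *ᵥ v) ⟨i, t⟩) ⬝ᵥ (R i *ᵥ fun t => (M *ᵥ x + K *ᵥ v) ⟨i, t⟩)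
          - φ i * sqNorm fun t => x ⟨i, t⟩) + (sqNorm (N *ᵥ x) - r * sqNorm v) := by
  set ω := M *ᵥ x + K *ᵥ v with hω
  have h1 : (permT w z u y) *ᵥ (couplingMap M N K *ᵥ Sum.elim x v)
      = Sum.elim (fun s => Sum.elim (fun t => x ⟨s.1, t⟩) (fun t => ω ⟨s.1, t⟩) s.2)
          (Sum.elim (N *ᵥ x) v) := by
    rw [couplingMap_mulVec, permT_mulVec]
    ext (⟨i, s | s⟩ | s | s) <;> rfl
  have h2 : ∀ Q : Matrix ((Σ i, z i ⊕ w i) ⊕ (y ⊕ u)) ((Σ i, z i ⊕ w i) ⊕ (y ⊕ u)) ℝ,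
      Sum.elim x v ⬝ᵥ (((couplingMap M N K)ᵀ * ((permT w z u y)ᵀ * Q * permT w z u y)
        * couplingMap M N K) *ᵥ Sum.elim x v)
      = ((permT w z u y) *ᵥ (couplingMap M N K *ᵥ Sum.elim x v)) ⬝ᵥ
        (Q *ᵥ ((permT w z u y) *ᵥ (couplingMap M N K *ᵥ Sum.elim x v))) := by
    intro Q
    simp only [← mulVec_mulVec]
    rw [dotProduct_mulVec, vecMul_transpose, dotProduct_mulVec, vecMul_transpose]
  rw [h2, h1, supplyQ, fromBlocks_mulVec, sumElim_dotProduct_sumElim]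
  simp only [Sum.elim_comp_inl, Sum.elim_comp_inr, zero_mulVec, add_zero, zero_add]
  congr 1
  · rw [dotProduct_sigma]
    refine Finset.sum_congr rfl fun i _ => ?_
    refine (congrArg
      (fun q => Sum.elim (fun t => x ⟨i, t⟩) (fun t => ω ⟨i, t⟩) ⬝ᵥ q)
      (blockDiagonal'_mulVec (a := fun i => z i ⊕ w i)
        (fun i => -supplyMatrix (φ i • (1 : Matrix (z i) (z i) ℝ)) 0 (R i))
        (fun s => Sum.elim (fun t => x ⟨s.1, t⟩) (fun t => ω ⟨s.1, t⟩) s.2) i)).trans ?_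
    have h3 := supplyMatrix_form (φ i) (R i) (fun t => x ⟨i, t⟩) (fun t => ω ⟨i, t⟩)
    rw [neg_mulVec, dotProduct_neg]
    exact (congrArg Neg.neg h3).trans (neg_sub _ _)
  · have := supplyMatrix_form 1 (r • (1 : Matrix u u ℝ)) (N *ᵥ x) v
    rw [one_smul] at this
    rw [this, smul_mulVec, one_mulVec, dotProduct_smul, dotProduct_self_eq_sqNorm]
    simp

end Coupling

/-- Finitely many strict affine inequalities at `0` persist for small positive arguments. -/
theorem eventually_affine_lt {ι : Type*} [Finite ι] {p q r : ι → ℝ} (h : ∀ i, p i < r i) :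
    ∀ᶠ η in nhdsWithin (0 : ℝ) (Set.Ioi 0), ∀ i, p i + η * q i < r i := by
  refine Filter.Eventually.filter_mono nhdsWithin_le_nhds (Filter.eventually_all.mpr fun i => ?_)
  have hc : Continuous fun η : ℝ => p i + η * q i := by fun_prop
  exact hc.continuousAt.eventually_lt continuousAt_const (by simpa using h i)

theorem hInfNorm_transfer_zero {a b c : Type*} [Fintype a] [DecidableEq a] [Fintype b]
    [DecidableEq b] [Fintype c] (A : Matrix a a ℝ) (C : Matrix c a ℝ) :
    hInfNorm (transfer A (0 : Matrix a b ℝ) C) = 0 := by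
  have h : ∀ s, transfer A (0 : Matrix a b ℝ) C s = 0 := by
    intro s
    rw [transfer, Matrix.map_zero _ Complex.ofReal_zero, Matrix.mul_zero]
  have h0 : sigmaMax (0 : Matrix c b ℂ) = 0 := by
    refine le_antisymm (sigmaMax_le le_rfl fun v => ?_) (sigmaMax_nonneg _)
    rw [zero_mulVec]
    simp [sqNorm]
  simp [hInfNorm, h, h0]

/-! ### Supply rates from the linear programming conditions -/

namespace Network

variable {n nI nO : ℕ} {nx nw nz : Fin n → ℕ} {nu : Fin nI → ℕ} {ny : Fin nO → ℕ}
  (S : Network n nI nO nx nw nz nu ny)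

/-- The vanishing diagonal blocks of M have gain 0, so the rows and columns of F can be summed over
all indices without singling out the diagonal. -/
theorem compF_eq (hM : ∀ i, block S.M i i = 0) :
    S.compF = Matrix.of (fun i j =>
      hInfNorm (transfer (S.A i) (S.B i * block S.M i j) (S.C i))) - 1 := by
  ext i j
  by_cases hij : i = j
  · subst hij
    simp [compF, hM, hInfNorm_transfer_zero]
  · simp [compF, hij]

/-- The supply rates and storage functions obtained from the linear programming conditions, with
strict local dissipation inequalities. -/
theorem exists_supply_rates (hA : ∀ i, IsHurwitz (S.A i)) (hM : ∀ i, block S.M i i = 0)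
    {δ : ℝ} {d e : Fin n → ℝ} {f : Fin nI → ℝ} {g : Fin nO → ℝ}
    (hd : ∀ i, 0 < d i) (he : ∀ i, 0 < e i) (hf : ∀ l, 0 < f l)
    (hLP : LPConditions S.compF S.compG S.compH 0 δ d e f g) :
    ∃ (Y : ∀ i, Matrix (Fin (nw i)) (Fin (nw i)) ℝ) (P : ∀ i, Matrix (Fin (nx i)) (Fin (nx i)) ℝ),
      (∀ i, (Y i).PosDef) ∧ (∀ i, (P i).PosDef) ∧
      (∀ i, ∀ v : Fin (nx i) ⊕ Fin (nw i) → ℝ, v ≠ 0 →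
        v ⬝ᵥ (fromBlocks (P i * S.A i + (S.A i)ᵀ * P i
          + (S.C i)ᵀ * ((e i / d i) • (1 : Matrix (Fin (nz i)) (Fin (nz i)) ℝ)) * S.C i)
          (P i * S.B i) (P i * S.B i)ᵀ (-(Y i)) *ᵥ v) < 0) ∧
      ∀ (z : (Σ i, Fin (nz i)) → ℝ) (u : (Σ l, Fin (nu l)) → ℝ),
        ∑ i, ((fun t => (S.M *ᵥ z + S.K *ᵥ u) ⟨i, t⟩) ⬝ᵥ
            (Y i *ᵥ fun t => (S.M *ᵥ z + S.K *ᵥ u) ⟨i, t⟩)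
          - e i / d i * sqNorm fun t => z ⟨i, t⟩) + (sqNorm (S.N *ᵥ z) - δ ^ 2 * sqNorm u) ≤ 0 := by
  set α : Fin n → Fin n → ℝ := fun i j =>
    hInfNorm (transfer (S.A i) (S.B i * block S.M i j) (S.C i)) with hα
  set β : Fin n → Fin nI → ℝ := fun i l =>
    hInfNorm (transfer (S.A i) (S.B i * block S.K i l) (S.C i)) with hβ
  set τ : Fin n → ℝ := fun i => hInfNorm (transfer (S.A i) (S.B i) (S.C i)) with hτ
  have hα0 : ∀ i j, 0 ≤ α i j := fun i j => hInfNorm_nonneg _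
  have hβ0 : ∀ i l, 0 ≤ β i l := fun i l => hInfNorm_nonneg _
  obtain ⟨hLP1, hLP2, hLP3, hLP4⟩ := hLP
  rw [compF_eq S hM] at hLP1 hLP3
  have h1 : ∀ i, ∑ j, α i j * d j + ∑ l, β i l * f l < d i := by
    intro i
    have := hLP1 i
    simp only [sub_mulVec, one_mulVec, Pi.add_apply, Pi.sub_apply, mulVec, dotProduct, of_apply,
      compG] at this
    linarith
  have h2 : ∀ k, ∑ j, sigmaMax (block S.N k j) * d j ≤ g k := by
    intro k
    have := hLP2 k
    simpa [mulVec, dotProduct, compH] using this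
  have h3 : ∀ j, ∑ i, α i j * e i + ∑ k, sigmaMax (block S.N k j) * g k < e j := by
    intro j
    have := hLP3 j
    simp only [transpose_sub, transpose_one, sub_mulVec, one_mulVec, Pi.add_apply, Pi.sub_apply,
      mulVec, dotProduct, transpose_apply, of_apply, compH] at this
    linarith
  have h4 : ∀ l, ∑ i, β i l * e i < δ ^ 2 * f l := by
    intro l
    have := hLP4 l
    simpa [mulVec, dotProduct, compG] using this
  -- Enlarging every gain by η keeps the weights defined when a gain is zero. The perturbations
  -- record its cost in each inequality; e i * τ i ^ 2 pays for the regularising term ηI in X.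
  obtain ⟨η, ⟨⟨hη1, hη3⟩, hη4⟩, hη⟩ := (((eventually_affine_lt
    (q := fun i => ∑ j, d j + ∑ l, f l + e i * τ i ^ 2) h1).and
    (eventually_affine_lt (q := fun _ => ∑ i, e i) h3)).and
    (eventually_affine_lt (q := fun _ => ∑ i, e i) h4) |>.and
    (self_mem_nhdsWithin (s := Set.Ioi (0 : ℝ)))).exists
  have hη : 0 < η := hη
  have hαη : ∀ i j, 0 < α i j + η := fun i j => add_pos_of_nonneg_of_pos (hα0 i j) hη
  have hβη : ∀ i l, 0 < β i l + η := fun i l => add_pos_of_nonneg_of_pos (hβ0 i l) hη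
  have hterm : ∀ {p q r : ℝ}, 0 ≤ p → 0 < q → 0 < r → q / ((p + η) * r) * p ^ 2
      ≤ (p + η) * q / r := by
    intro p q r hp hq hr
    have hpη : 0 < p + η := by linarith
    rw [div_mul_eq_mul_div, div_le_div_iff₀ (by positivity) hr]
    have : p ^ 2 ≤ (p + η) ^ 2 := pow_le_pow_left₀ hp (by linarith) 2
    have h5 : 0 ≤ q * r := by positivity
    nlinarith
  -- The weight d_j/((α_ij + η)e_i) serves both sides: times α_ij² it is at most (α_ij + η)d_j/e_i,
  -- as in the inequality for Fd + Gf, and its reciprocal (α_ij + η)e_i/d_j produces the sums in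
  -- Fᵀe.
  have hsub : ∀ i, ∃ (Y : Matrix (Fin (nw i)) (Fin (nw i)) ℝ)
      (P : Matrix (Fin (nx i)) (Fin (nx i)) ℝ), Y.PosDef ∧ P.PosDef ∧ _ ∧ _ := fun i =>
    exists_supply_of_gain_bound (hA i) (S.B i) (S.C i) (φ := e i / d i) (ε := η)
      (div_pos (he i) (hd i)) hη (fun j => block S.M i j) (fun l => block S.K i l)
      (α := fun j => d j / ((α i j + η) * e i)) (β := fun l => f l / ((β i l + η) * e i))
      (fun j => div_pos (hd j) (mul_pos (hαη i j) (he i)))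
      (fun l => div_pos (hf l) (mul_pos (hβη i l) (he i))) (by
        have hi := he i
        have hdi := hd i
        have b1 : ∑ j, d j / ((α i j + η) * e i) * α i j ^ 2 ≤ ∑ j, (α i j + η) * d j / e i :=
          Finset.sum_le_sum fun j _ => hterm (hα0 i j) (hd j) (he i)
        have b2 : ∑ l, f l / ((β i l + η) * e i) * β i l ^ 2 ≤ ∑ l, (β i l + η) * f l / e i :=
          Finset.sum_le_sum fun l _ => hterm (hβ0 i l) (hf l) (he i)
        have b3 := hη1 i
        rw [← Finset.sum_div] at b1 b2
        simp only [add_mul, Finset.sum_add_distrib, ← Finset.mul_sum] at b1 b2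
        have b4 : e i / d i * ((∑ j, α i j * d j + η * ∑ j, d j) / e i
            + (∑ l, β i l * f l + η * ∑ l, f l) / e i + η * τ i ^ 2) < 1 := by
          have : e i / d i * ((∑ j, α i j * d j + η * ∑ j, d j) / e i
            + (∑ l, β i l * f l + η * ∑ l, f l) / e i + η * τ i ^ 2)
            = (∑ j, α i j * d j + ∑ l, β i l * f l
              + η * (∑ j, d j + ∑ l, f l + e i * τ i ^ 2)) / d i := by
            field_simp
            ring
          rw [this, div_lt_one hdi]
          exact b3
        refine lt_of_le_of_lt (mul_le_mul_of_nonneg_left ?_ (div_pos hi hdi).le) b4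
        simp only [add_mul] at b1 b2 ⊢
        gcongr)
  choose Y P hY hP hneg hcoup using hsub
  refine ⟨Y, P, hY, hP, hneg, fun z u => ?_⟩
  have c1 : ∀ i, (fun t => (S.M *ᵥ z + S.K *ᵥ u) ⟨i, t⟩)
      = ∑ j, block S.M i j *ᵥ (fun t => z ⟨j, t⟩) + ∑ l, block S.K i l *ᵥ fun t => u ⟨l, t⟩ := by
    intro i
    rw [← mulVec_sigma, ← mulVec_sigma]
    rfl
  have c2 : ∑ i, ((fun t => (S.M *ᵥ z + S.K *ᵥ u) ⟨i, t⟩) ⬝ᵥ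
        (Y i *ᵥ fun t => (S.M *ᵥ z + S.K *ᵥ u) ⟨i, t⟩))
      ≤ ∑ j, (∑ i, (α i j + η) * e i) * (sqNorm (fun t => z ⟨j, t⟩) / d j)
        + ∑ l, (∑ i, (β i l + η) * e i) * (sqNorm (fun t => u ⟨l, t⟩) / f l) := by
    have : ∀ i, (fun t => (S.M *ᵥ z + S.K *ᵥ u) ⟨i, t⟩) ⬝ᵥ
        (Y i *ᵥ fun t => (S.M *ᵥ z + S.K *ᵥ u) ⟨i, t⟩)
        ≤ ∑ j, (α i j + η) * e i * (sqNorm (fun t => z ⟨j, t⟩) / d j)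
          + ∑ l, (β i l + η) * e i * (sqNorm (fun t => u ⟨l, t⟩) / f l) := by
      intro i
      rw [c1]
      refine (hcoup i (fun j t => z ⟨j, t⟩) fun l t => u ⟨l, t⟩).trans_eq ?_
      congr 1 <;> refine Finset.sum_congr rfl fun j _ => ?_
      all_goals rw [div_div_eq_mul_div, mul_comm, mul_div_assoc]
    refine (Finset.sum_le_sum fun i _ => this i).trans_eq ?_
    rw [Finset.sum_add_distrib, Finset.sum_comm]
    nth_rewrite 2 [Finset.sum_comm]
    simp only [Finset.sum_mul]
  have c3 := sqNorm_mulVec_le_of_gain S.N hd h2 z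
  -- The inequality for Fᵀe + Hᵀg, multiplied by |z_j|²/d_j.
  have c4 : ∀ j, (∑ i, (α i j + η) * e i) * (sqNorm (fun t => z ⟨j, t⟩) / d j)
      + (∑ k, sigmaMax (block S.N k j) * g k) * (sqNorm (fun t => z ⟨j, t⟩) / d j)
      ≤ e j / d j * sqNorm fun t => z ⟨j, t⟩ := by
    intro j
    rw [← add_mul, div_mul_eq_mul_div, ← mul_div_assoc']
    refine mul_le_mul_of_nonneg_right ?_ (div_nonneg (sqNorm_nonneg _) (hd j).le)
    have := hη3 j
    simp only [add_mul, Finset.sum_add_distrib, ← Finset.mul_sum]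
    linarith
  have c5 : ∀ l, (∑ i, (β i l + η) * e i) * (sqNorm (fun t => u ⟨l, t⟩) / f l)
      ≤ δ ^ 2 * sqNorm fun t => u ⟨l, t⟩ := by
    intro l
    have := hη4 l
    have h5 : ∑ i, (β i l + η) * e i ≤ δ ^ 2 * f l := by
      simp only [add_mul, Finset.sum_add_distrib, ← Finset.mul_sum]
      linarith
    refine (mul_le_mul_of_nonneg_right h5 (div_nonneg (sqNorm_nonneg _) (hf l).le)).trans_eq ?_
    have := (hf l).ne'
    field_simp
  have c6 := Finset.sum_le_sum fun j (_ : j ∈ Finset.univ) => c4 j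
  have c7 := Finset.sum_le_sum fun l (_ : l ∈ Finset.univ) => c5 l
  rw [Finset.sum_add_distrib] at c6
  rw [← Finset.mul_sum, ← sqNorm_sigma] at c7
  rw [Finset.sum_sub_distrib]
  linarith

end Network

/-- A real symmetric matrix with nonpositive quadratic form is negative semidefinite. -/
theorem negSemidef_of_form {a : Type*} [Fintype a] {X : Matrix a a ℝ} (hX : Xᵀ = X)
    (h : ∀ v : a → ℝ, v ⬝ᵥ (X *ᵥ v) ≤ 0) : NegSemidef X := by
  refine PosSemidef.of_dotProduct_mulVec_nonneg ?_ fun v => ?_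
  · rw [IsHermitian, conjTranspose_eq_transpose_of_trivial, transpose_neg, hX]
  · rw [neg_mulVec, dotProduct_neg]
    simpa using h v

theorem negDef_of_form {a : Type*} [Fintype a] {X : Matrix a a ℝ} (hX : Xᵀ = X)
    (h : ∀ v : a → ℝ, v ≠ 0 → v ⬝ᵥ (X *ᵥ v) < 0) : NegDef X := by
  refine PosDef.of_dotProduct_mulVec_pos ?_ fun v hv => ?_
  · rw [IsHermitian, conjTranspose_eq_transpose_of_trivial, transpose_neg, hX]
  · rw [neg_mulVec, dotProduct_neg]
    simpa using h v hv

theorem posDef_blockDiagonal' {ι : Type*} [Fintype ι] [DecidableEq ι] {a : ι → Type*}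
    [∀ i, Fintype (a i)] {P : ∀ i, Matrix (a i) (a i) ℝ} (hP : ∀ i, (P i).PosDef) :
    (blockDiagonal' P).PosDef := by
  have hPs : (blockDiagonal' P)ᵀ = blockDiagonal' P := by
    rw [blockDiagonal'_transpose]
    congr 1
    ext1 i
    exact PosDef.transpose_eq (hP i)
  refine PosDef.of_dotProduct_mulVec_pos ?_ fun v hv => ?_
  · rw [IsHermitian, conjTranspose_eq_transpose_of_trivial, hPs]
  · rw [star_trivial, dotProduct_sigma]
    simp only [blockDiagonal'_mulVec]
    have hex : ∃ i, (fun t => v ⟨i, t⟩) ≠ 0 := by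
      by_contra hcon
      push Not at hcon
      exact hv (funext fun s => congrFun (hcon s.1) s.2)
    obtain ⟨i, hi⟩ := hex
    refine Finset.sum_pos' (fun j _ => ?_)
      ⟨i, Finset.mem_univ i, quadratic_pos_of_posDef (hP i) _ hi⟩
    by_cases h0 : (fun t => v ⟨j, t⟩) = 0
    · rw [h0, zero_dotProduct]
    · exact (quadratic_pos_of_posDef (hP j) _ h0).le

/-! ### From dissipativity to the Riccati inequality -/

namespace Network

variable {n nI nO : ℕ} {nx nw nz : Fin n → ℕ} {nu : Fin nI → ℕ} {ny : Fin nO → ℕ}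
  (S : Network n nI nO nx nw nz nu ny)

/-- Local strict dissipativity and the coupling inequality give the strict Riccati inequality of
the interconnection, with block diagonal storage matrix. -/
theorem riccati_form_neg {δ : ℝ} (hδ : 0 < δ) {φ : Fin n → ℝ}
    {Y : ∀ i, Matrix (Fin (nw i)) (Fin (nw i)) ℝ} {P : ∀ i, Matrix (Fin (nx i)) (Fin (nx i)) ℝ}
    (hP : ∀ i, (P i)ᵀ = P i)
    (hneg : ∀ i, ∀ v : Fin (nx i) ⊕ Fin (nw i) → ℝ, v ≠ 0 →
        v ⬝ᵥ (fromBlocks (P i * S.A i + (S.A i)ᵀ * P i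
          + (S.C i)ᵀ * (φ i • (1 : Matrix (Fin (nz i)) (Fin (nz i)) ℝ)) * S.C i)
          (P i * S.B i) (P i * S.B i)ᵀ (-(Y i)) *ᵥ v) < 0)
    (hcoup : ∀ (z : (Σ i, Fin (nz i)) → ℝ) (u : (Σ l, Fin (nu l)) → ℝ),
        ∑ i, ((fun t => (S.M *ᵥ z + S.K *ᵥ u) ⟨i, t⟩) ⬝ᵥ
            (Y i *ᵥ fun t => (S.M *ᵥ z + S.K *ᵥ u) ⟨i, t⟩)
          - φ i * sqNorm fun t => z ⟨i, t⟩) + (sqNorm (S.N *ᵥ z) - δ ^ 2 * sqNorm u) ≤ 0)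
    (x : (Σ i, Fin (nx i)) → ℝ) (hx : x ≠ 0) :
    x ⬝ᵥ ((blockDiagonal' P * S.fullA + S.fullAᵀ * blockDiagonal' P + S.fullCᵀ * S.fullC
      + (1 / δ ^ 2) • (blockDiagonal' P * S.fullB * S.fullBᵀ * blockDiagonal' P)) *ᵥ x) < 0 := by
  set D := blockDiagonal' P with hD
  have hDs : Dᵀ = D := by
    rw [hD, blockDiagonal'_transpose]
    congr 1
    ext1 i
    exact hP i
  set p := D *ᵥ x with hp
  set z := blockDiagonal' S.C *ᵥ x with hz
  -- This input maximises 2 pᵀBu - δ²|u|², with maximum δ⁻²|Bᵀp|², the quadratic term of the Riccati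
  -- expression.
  set u := (1 / δ ^ 2) • (S.fullBᵀ *ᵥ p) with hu
  set w := S.M *ᵥ z + S.K *ᵥ u with hw
  have hcxu := hcoup z u
  have hstate : S.fullA *ᵥ x + S.fullB *ᵥ u
      = blockDiagonal' S.A *ᵥ x + blockDiagonal' S.B *ᵥ w := by
    rw [fullA, fullB, add_mulVec, hw, mulVec_add, hz]
    simp only [mulVec_mulVec, Matrix.mul_assoc, add_assoc]
  have hlocal : 2 * (p ⬝ᵥ (S.fullA *ᵥ x + S.fullB *ᵥ u))
      + ∑ i, (φ i * sqNorm (fun t => z ⟨i, t⟩)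
        - (fun t => w ⟨i, t⟩) ⬝ᵥ (Y i *ᵥ fun t => w ⟨i, t⟩)) < 0 := by
    have e : ∀ i, Sum.elim (fun t => x ⟨i, t⟩) (fun t => w ⟨i, t⟩) ⬝ᵥ
        (fromBlocks (P i * S.A i + (S.A i)ᵀ * P i
          + (S.C i)ᵀ * (φ i • (1 : Matrix (Fin (nz i)) (Fin (nz i)) ℝ)) * S.C i)
          (P i * S.B i) (P i * S.B i)ᵀ (-(Y i)) *ᵥ
            Sum.elim (fun t => x ⟨i, t⟩) (fun t => w ⟨i, t⟩))
        = 2 * ((fun t => p ⟨i, t⟩) ⬝ᵥ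
            fun t => (blockDiagonal' S.A *ᵥ x + blockDiagonal' S.B *ᵥ w) ⟨i, t⟩)
          + (φ i * sqNorm (fun t => z ⟨i, t⟩)
            - (fun t => w ⟨i, t⟩) ⬝ᵥ (Y i *ᵥ fun t => w ⟨i, t⟩)) := by
      intro i
      rw [dissipation_form (hP i), ← blockDiagonal'_mulVec P x i, ← blockDiagonal'_mulVec S.A x i,
        ← blockDiagonal'_mulVec S.B w i, ← blockDiagonal'_mulVec S.C x i, add_sub_assoc]
      rfl
    rw [hstate, dotProduct_sigma, Finset.mul_sum, ← Finset.sum_add_distrib]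
    simp only [← e]
    have hex : ∃ i, (fun t => x ⟨i, t⟩) ≠ 0 := by
      by_contra hcon
      push Not at hcon
      exact hx (funext fun s => congrFun (hcon s.1) s.2)
    obtain ⟨i, hi⟩ := hex
    refine Finset.sum_neg' (fun j _ => ?_) ⟨i, Finset.mem_univ i, hneg i _ fun h0 =>
      hi (funext fun t => congrFun h0 (Sum.inl t))⟩
    by_cases h0 : Sum.elim (fun t => x ⟨j, t⟩) (fun t => w ⟨j, t⟩) = 0
    · rw [h0, zero_dotProduct]
    · exact (hneg j _ h0).le
  have hNz : S.N *ᵥ z = S.fullC *ᵥ x := by rw [hz, fullC, mulVec_mulVec]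
  have hpB : p ⬝ᵥ (S.fullB *ᵥ u) = 1 / δ ^ 2 * sqNorm (S.fullBᵀ *ᵥ p) := by
    rw [dotProduct_mulVec, ← mulVec_transpose, hu, dotProduct_smul, dotProduct_self_eq_sqNorm,
      smul_eq_mul]
  have hsu : δ ^ 2 * sqNorm u = 1 / δ ^ 2 * sqNorm (S.fullBᵀ *ᵥ p) := by
    rw [hu, ← dotProduct_self_eq_sqNorm, smul_dotProduct, dotProduct_smul,
      dotProduct_self_eq_sqNorm, smul_eq_mul, smul_eq_mul]
    field_simp
  have hDx : ∀ v, x ⬝ᵥ (D *ᵥ v) = p ⬝ᵥ v := fun v => by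
    rw [dotProduct_mulVec, ← mulVec_transpose, hDs]
  have hform : x ⬝ᵥ ((D * S.fullA + S.fullAᵀ * D + S.fullCᵀ * S.fullC
      + (1 / δ ^ 2) • (D * S.fullB * S.fullBᵀ * D)) *ᵥ x)
      = 2 * (p ⬝ᵥ (S.fullA *ᵥ x)) + sqNorm (S.fullC *ᵥ x)
        + 1 / δ ^ 2 * sqNorm (S.fullBᵀ *ᵥ p) := by
    have e1 : x ⬝ᵥ (S.fullAᵀ *ᵥ p) = p ⬝ᵥ (S.fullA *ᵥ x) := by
      rw [dotProduct_mulVec, vecMul_transpose, dotProduct_comm]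
    have e2 : x ⬝ᵥ (S.fullCᵀ *ᵥ (S.fullC *ᵥ x)) = sqNorm (S.fullC *ᵥ x) := by
      rw [dotProduct_mulVec, vecMul_transpose, dotProduct_self_eq_sqNorm]
    have e3 : p ⬝ᵥ (S.fullB *ᵥ (S.fullBᵀ *ᵥ p)) = sqNorm (S.fullBᵀ *ᵥ p) := by
      rw [dotProduct_mulVec, ← mulVec_transpose, dotProduct_self_eq_sqNorm]
    simp only [add_mulVec, smul_mulVec, dotProduct_add, dotProduct_smul, ← mulVec_mulVec, hDx,
      ← hp, e1, e2, e3, smul_eq_mul]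
    ring
  rw [hform]
  rw [dotProduct_add, hpB] at hlocal
  rw [hNz, hsu, Finset.sum_sub_distrib] at hcxu
  rw [Finset.sum_sub_distrib] at hlocal
  linarith

end Network

end SmallGain

/-! ### The small-gain theorem -/

theorem mainTheorem5 {n nI nO : ℕ} {nx nw nz : Fin n → ℕ} {nu : Fin nI → ℕ} {ny : Fin nO → ℕ}
    (S : SmallGain.Network n nI nO nx nw nz nu ny)
    (hA : ∀ i, SmallGain.IsHurwitz (S.A i))
    (hM : ∀ i, SmallGain.block S.M i i = 0)
    (δ : ℝ) (hδ : 0 < δ)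
    (d e : Fin n → ℝ) (f : Fin nI → ℝ) (g : Fin nO → ℝ)
    (hd : ∀ i, 0 < d i) (he : ∀ i, 0 < e i) (hf : ∀ l, 0 < f l) (hg : ∀ k, 0 < g k)
    (hLP : SmallGain.LPConditions S.compF S.compG S.compH 0 δ d e f g) :
    (∃ (Y22 : ∀ i, Matrix (Fin (nw i)) (Fin (nw i)) ℝ)
        (P : ∀ i, Matrix (Fin (nx i)) (Fin (nx i)) ℝ),
      (∀ i, ((e i / d i) • (1 : Matrix (Fin (nz i)) (Fin (nz i)) ℝ)).PosDef) ∧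
      (∀ i, (Y22 i).PosDef) ∧
      (∀ i, SmallGain.LocalSupplyCond (S.A i) (S.B i) (S.C i) (P i)
        ((e i / d i) • 1) 0 (Y22 i)) ∧
      SmallGain.GlobalSupplyCond S.M S.N S.K
        (fun i => SmallGain.supplyMatrix ((e i / d i) • 1) 0 (Y22 i))
        (SmallGain.supplyMatrix 1 0 ((δ ^ 2) • 1))) ∧
    (∃ P : ∀ i, Matrix (Fin (nx i)) (Fin (nx i)) ℝ,
      (∀ i, (P i).PosDef) ∧
      SmallGain.NegDef
        (Matrix.blockDiagonal' P * S.fullA + S.fullA.transpose * Matrix.blockDiagonal' P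
          + S.fullC.transpose * S.fullC
          + (1 / δ ^ 2) • (Matrix.blockDiagonal' P * S.fullB * S.fullB.transpose
              * Matrix.blockDiagonal' P))) ∧
    SmallGain.IsHurwitz S.fullA ∧
    SmallGain.hInfNorm (SmallGain.transfer S.fullA S.fullB S.fullC) < δ := by
  -- One family P serves in both (i) and (ii). The local inequalities come out strict, which is why
  -- the nonstrict coupling condition suffices for a strict Riccati inequality.
  obtain ⟨Y, P, hY, hP, hneg, hcoup⟩ := S.exists_supply_rates hA hM hd he hf hLP
  have hPs := fun i => SmallGain.PosDef.transpose_eq (hP i)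
  have hYs := fun i => SmallGain.PosDef.transpose_eq (hY i)
  have hdiag : (Matrix.blockDiagonal' P).transpose = Matrix.blockDiagonal' P :=
    SmallGain.PosDef.transpose_eq (SmallGain.posDef_blockDiagonal' hP)
  have hric := S.riccati_form_neg hδ hPs hneg hcoup
  refine ⟨⟨Y, P, fun i => Matrix.PosDef.one.smul (div_pos (he i) (hd i)), hY,
    fun i => ⟨?_, hP i, ?_⟩, ?_, ?_⟩, ⟨P, hP, ?_⟩, ?_, ?_⟩
  · simp [Matrix.IsSymm, SmallGain.supplyMatrix, Matrix.fromBlocks_transpose, hYs]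
  · rw [Matrix.mul_zero, add_zero]
    refine SmallGain.negSemidef_of_form ?_ fun v => ?_
    · simp only [Matrix.fromBlocks_transpose, Matrix.transpose_add, Matrix.transpose_mul,
        Matrix.transpose_transpose, Matrix.transpose_neg, Matrix.transpose_smul,
        Matrix.transpose_one, hPs, hYs, Matrix.mul_assoc]
      rw [add_comm ((S.A i).transpose * P i)]
    · by_cases hv : v = 0
      · rw [hv, zero_dotProduct]
      · exact (hneg i v hv).le
  · simp [Matrix.IsSymm, SmallGain.supplyMatrix, Matrix.fromBlocks_transpose]
  · refine SmallGain.negSemidef_of_form ?_ fun v => ?_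
    · have hQ := SmallGain.supplyQ_transpose
        (fun i => SmallGain.supplyMatrix ((e i / d i) • (1 : Matrix (Fin (nz i)) (Fin (nz i)) ℝ)) 0
          (Y i))
        (SmallGain.supplyMatrix (1 : Matrix (Σ k, Fin (ny k)) (Σ k, Fin (ny k)) ℝ) 0
          ((δ ^ 2) • (1 : Matrix (Σ l, Fin (nu l)) (Σ l, Fin (nu l)) ℝ)))
        (fun i => by simp [SmallGain.supplyMatrix, Matrix.fromBlocks_transpose, hYs])
        (by simp [SmallGain.supplyMatrix, Matrix.fromBlocks_transpose])
      simp only [Matrix.transpose_mul, Matrix.transpose_transpose, hQ, Matrix.mul_assoc]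
    · rw [← Sum.elim_comp_inl_inr v, SmallGain.coupling_form]
      exact hcoup _ _
  · refine SmallGain.negDef_of_form ?_ hric
    simp only [Matrix.transpose_add, Matrix.transpose_mul, Matrix.transpose_transpose,
      Matrix.transpose_smul, hdiag, Matrix.mul_assoc]
    rw [add_comm (S.fullA.transpose * Matrix.blockDiagonal' P)]
  · exact SmallGain.isHurwitz_of_riccati S.fullB S.fullC (by positivity)
      (SmallGain.posDef_blockDiagonal' hP) hric
  · exact SmallGain.hInfNorm_lt_of_riccati S.fullB S.fullC hδ
      (SmallGain.posDef_blockDiagonal' hP) hric
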